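/- Let $\Omega\subset\mathbb R^n$ be open (in particular, any domain), let $T>0$, $I=(0,T)$, $V=H^1(\Omega)$ and $H=L^2(\Omega)$ (real-valued functions), with the evolution triple $V\subset H=H^*\subset V^*$. Let $$u\in W:=\{u\in L^2(I;V):\ \partial_t u\in L^2(I;V^*)\},$$ where $\partial_t$ denotes the weak derivative with respect to $t$. Then $u$ has a representative in $C([0,T];H)$, which defines $u(t)\in H$ for every $t\in[0,T]$; the positive part $u^+=\max(u,0)$ belongs to $L^2(I;V)$; the functions $t\mapsto\langle \partial_t u(t),u^+(t)\rangle_{V^*,V}$ and $t\mapsto \partial_t\|u^+(t)\|_H^2$ (weak derivative of the continuous function $t\mapsto\|u^+(t)\|_H^2$) are integrable on $I$; and $$\int_0^T\langle \partial_t u(t),u^+(t)\rangle_{V^*,V}\,dt=\frac12\int_0^T\partial_t\|u^+(t)\|_H^2\,dt=\frac12\left(\|u^+(T)\|_H^2-\|u^+(0)\|_H^2\right).$$ -/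

import Mathlib

open MeasureTheory Set
open scoped ContDiff

noncomputable section

/-- Euclidean space `ℝⁿ`. -/
abbrev Eucl (n : ℕ) : Type := EuclideanSpace ℝ (Fin n)

/-- The space `H = L²(Ω)` of real-valued functions, with its standard norm and inner product. -/
abbrev L2Space {n : ℕ} (Ω : Set (Eucl n)) : Type :=
  Lp ℝ 2 (volume.restrict Ω)

/-- The space `L²(Ω; ℝⁿ)` of square integrable vector fields. -/
abbrev L2Field {n : ℕ} (Ω : Set (Eucl n)) : Type :=
  Lp (Eucl n) 2 (volume.restrict Ω)

/-- `g` is the weak gradient of `f` on `Ω`: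
`∫_Ω f ∂ᵢφ dx = - ∫_Ω gᵢ φ dx` for all `i` and all test functions `φ ∈ C_c^∞(Ω)`. -/
def HasWeakGradient {n : ℕ} (Ω : Set (Eucl n)) (f : Eucl n → ℝ) (g : Eucl n → Eucl n) : Prop :=
  ∀ φ : Eucl n → ℝ, ContDiff ℝ ∞ φ → HasCompactSupport φ → tsupport φ ⊆ Ω →
    ∀ i : Fin n,
      ∫ x in Ω, f x * fderiv ℝ φ x (EuclideanSpace.single i 1) = -∫ x in Ω, g x i * φ x

theorem integrable_L2_mul_test {n : ℕ} {Ω : Set (Eucl n)} (f : Eucl n → ℝ)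
    (hf : MemLp f 2 (volume.restrict Ω)) (ψ : Eucl n → ℝ) (hψ : Continuous ψ)
    (hc : HasCompactSupport ψ) : Integrable (fun x => f x * ψ x) (volume.restrict Ω) :=
  hf.integrable_mul (q := 2) (hψ.memLp_of_hasCompactSupport hc)

theorem memLp_coord {n : ℕ} {Ω : Set (Eucl n)} (g : L2Field Ω) (i : Fin n) :
    MemLp (fun x => g x i) 2 (volume.restrict Ω) :=
  (EuclideanSpace.proj i : Eucl n →L[ℝ] ℝ).comp_memLp' (Lp.memLp g)

theorem continuous_partial {n : ℕ} {φ : Eucl n → ℝ} (h : ContDiff ℝ ∞ φ) (e : Eucl n) :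
    Continuous (fun x => fderiv ℝ φ x e) :=
  (h.continuous_fderiv (by simp)).clm_apply continuous_const

theorem compactSupport_partial {n : ℕ} {φ : Eucl n → ℝ} (h : HasCompactSupport φ) (e : Eucl n) :
    HasCompactSupport (fun x => fderiv ℝ φ x e) :=
  h.fderiv_apply ℝ e

/-- The pairs `(f, ∇f)` in the Hilbert direct sum `L²(Ω) × L²(Ω; ℝⁿ)` for which `∇f` is the weak
gradient of `f`. -/
def sobolevSubmodule {n : ℕ} (Ω : Set (Eucl n)) :
    Submodule ℝ (WithLp 2 (L2Space Ω × L2Field Ω)) where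
  carrier := {p | HasWeakGradient Ω p.fst p.snd}
  zero_mem' := by
    intro φ _ _ _ i
    have h1 : ∫ x in Ω, (0 : L2Space Ω) x * fderiv ℝ φ x (EuclideanSpace.single i 1) = 0 := by
      rw [← integral_zero (Eucl n) ℝ]
      refine integral_congr_ae ?_
      filter_upwards [Lp.coeFn_zero ℝ 2 (volume.restrict Ω)] with x hx
      rw [hx]
      simp
    have h2 : ∫ x in Ω, (0 : L2Field Ω) x i * φ x = 0 := by
      rw [← integral_zero (Eucl n) ℝ]
      refine integral_congr_ae ?_
      filter_upwards [Lp.coeFn_zero (Eucl n) 2 (volume.restrict Ω)] with x hx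
      rw [hx]
      simp
    simp only [WithLp.zero_fst, WithLp.zero_snd]
    rw [h1, h2, neg_zero]
  add_mem' := by
    intro p q hp hq φ h1 h2 h3 i
    have e1 : ∫ x in Ω, (p + q).fst x * fderiv ℝ φ x (EuclideanSpace.single i 1)
        = (∫ x in Ω, p.fst x * fderiv ℝ φ x (EuclideanSpace.single i 1))
          + ∫ x in Ω, q.fst x * fderiv ℝ φ x (EuclideanSpace.single i 1) := by
      rw [← integral_add
        (integrable_L2_mul_test _ (Lp.memLp p.fst) _ (continuous_partial h1 _)
          (compactSupport_partial h2 _))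
        (integrable_L2_mul_test _ (Lp.memLp q.fst) _ (continuous_partial h1 _)
          (compactSupport_partial h2 _))]
      refine integral_congr_ae ?_
      filter_upwards [Lp.coeFn_add p.fst q.fst] with x hx
      rw [WithLp.add_fst, hx, Pi.add_apply, add_mul]
    have e2 : ∫ x in Ω, (p + q).snd x i * φ x
        = (∫ x in Ω, p.snd x i * φ x) + ∫ x in Ω, q.snd x i * φ x := by
      rw [← integral_add
        (integrable_L2_mul_test _ (memLp_coord p.snd i) _ h1.continuous h2)
        (integrable_L2_mul_test _ (memLp_coord q.snd i) _ h1.continuous h2)]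
      refine integral_congr_ae ?_
      filter_upwards [Lp.coeFn_add p.snd q.snd] with x hx
      rw [WithLp.add_snd, hx, Pi.add_apply, PiLp.add_apply, add_mul]
    rw [e1, e2, hp φ h1 h2 h3 i, hq φ h1 h2 h3 i, neg_add]
  smul_mem' := by
    intro c p hp φ h1 h2 h3 i
    have e1 : ∫ x in Ω, (c • p).fst x * fderiv ℝ φ x (EuclideanSpace.single i 1)
        = c * ∫ x in Ω, p.fst x * fderiv ℝ φ x (EuclideanSpace.single i 1) := by
      rw [← integral_const_mul]
      refine integral_congr_ae ?_
      filter_upwards [Lp.coeFn_smul c p.fst] with x hx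
      rw [WithLp.smul_fst, hx, Pi.smul_apply, smul_eq_mul, mul_assoc]
    have e2 : ∫ x in Ω, (c • p).snd x i * φ x = c * ∫ x in Ω, p.snd x i * φ x := by
      rw [← integral_const_mul]
      refine integral_congr_ae ?_
      filter_upwards [Lp.coeFn_smul c p.snd] with x hx
      rw [WithLp.smul_snd, hx, Pi.smul_apply, PiLp.smul_apply, smul_eq_mul, mul_assoc]
    rw [e1, e2, hp φ h1 h2 h3 i, mul_neg]

/-- The Sobolev space `V = H¹(Ω)`: each `f ∈ L²(Ω)` that has a weak gradient `∇f ∈ L²(Ω; ℝⁿ)` is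
represented by the pair `(f, ∇f)`. The inner product inherited from the Hilbert direct sum is
`∫_Ω f g + ∇f · ∇g dx`, and the norm is the associated one. -/
def SobolevH1 {n : ℕ} (Ω : Set (Eucl n)) : Type :=
  ↥(sobolevSubmodule Ω)

instance SobolevH1.instNormedAddCommGroup {n : ℕ} (Ω : Set (Eucl n)) :
    NormedAddCommGroup (SobolevH1 Ω) :=
  inferInstanceAs (NormedAddCommGroup ↥(sobolevSubmodule Ω))

instance SobolevH1.instInnerProductSpace {n : ℕ} (Ω : Set (Eucl n)) :
    InnerProductSpace ℝ (SobolevH1 Ω) :=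
  inferInstanceAs (InnerProductSpace ℝ ↥(sobolevSubmodule Ω))

/-- The dual space `V* = H¹(Ω)*`, with the operator norm; the duality pairing
`⟨ξ, v⟩_{V*,V}` is the evaluation `ξ v`. -/
abbrev SobolevH1Dual {n : ℕ} (Ω : Set (Eucl n)) : Type :=
  StrongDual ℝ (SobolevH1 Ω)

/-- The embedding `V = H¹(Ω) → H = L²(Ω)`. -/
def SobolevH1.toL2 {n : ℕ} (Ω : Set (Eucl n)) : SobolevH1 Ω →L[ℝ] L2Space Ω :=
  (WithLp.fstL 2 ℝ (L2Space Ω) (L2Field Ω)).comp (sobolevSubmodule Ω).subtypeL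

/-- The embedding `V → V*` of the evolution triple `V ⊂ H = H* ⊂ V*`: the function `v` acts by
`w ↦ (v, w)_H`. -/
def SobolevH1.toDual {n : ℕ} (Ω : Set (Eucl n)) (v : SobolevH1 Ω) : SobolevH1Dual Ω :=
  (innerSL ℝ (SobolevH1.toL2 Ω v)).comp (SobolevH1.toL2 Ω)

/-- `g` is the weak derivative of `f` on the time interval `(0, T)`, for functions with values in
a Banach space: `∫₀ᵀ φ'(t) f(t) dt = - ∫₀ᵀ φ(t) g(t) dt` for all `φ ∈ C_c^∞(0, T)`. -/
def HasWeakTimeDeriv {X : Type*} [NormedAddCommGroup X] [NormedSpace ℝ X] [CompleteSpace X]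
    (T : ℝ) (f g : ℝ → X) : Prop :=
  ∀ φ : ℝ → ℝ, ContDiff ℝ ∞ φ → HasCompactSupport φ → tsupport φ ⊆ Ioo 0 T →
    ∫ t in Ioo 0 T, deriv φ t • f t = -∫ t in Ioo 0 T, φ t • g t

/-- `u ∈ W` with `∂ₜu = u'`: `u` lies in `L²(0,T; V)`, and its weak time derivative in `V*`
(along the embedding `V ⊂ V*`) is `u' ∈ L²(0,T; V*)`. -/
structure IsInW {n : ℕ} (Ω : Set (Eucl n)) (T : ℝ)
    (u : ℝ → SobolevH1 Ω) (u' : ℝ → SobolevH1Dual Ω) : Prop where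
  memLp : MemLp u 2 (volume.restrict (Ioo 0 T))
  memLp_deriv : MemLp u' 2 (volume.restrict (Ioo 0 T))
  weakDeriv : HasWeakTimeDeriv T (fun t => SobolevH1.toDual Ω (u t)) u'

/-- `ub : [0,T] → H` is the continuous representative of `u`, that is, the image of `u` under
the embedding of `W` into `C([0,T]; H)`; its values at `0` and `T` are what `u(0)` and `u(T)`
mean. -/
structure IsContRep {n : ℕ} (Ω : Set (Eucl n)) (T : ℝ)
    (u : ℝ → SobolevH1 Ω) (ub : ℝ → L2Space Ω) : Prop where
  continuousOn : ContinuousOn ub (Icc 0 T)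
  ae_eq : ∀ᵐ t ∂(volume.restrict (Ioo 0 T)), ub t = SobolevH1.toL2 Ω (u t)

/-- `up` is the positive part `u⁺ = max(u, 0)` of `u`, as an element of `L²(0,T; V)`. -/
structure IsPosPartInL2V {n : ℕ} (Ω : Set (Eucl n)) (T : ℝ)
    (u up : ℝ → SobolevH1 Ω) : Prop where
  memLp : MemLp up 2 (volume.restrict (Ioo 0 T))
  ae_eq : ∀ᵐ t ∂(volume.restrict (Ioo 0 T)),
    SobolevH1.toL2 Ω (up t) = Lp.posPart (SobolevH1.toL2 Ω (u t))

end

open Filter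
open scoped Topology RealInnerProductSpace Convolution

/-! The functional Φ(x) = ½‖x⁺‖² on H is convex with gradient x⁺, so ⟨x - y, y⁺⟩ ≤ Φ(x) - Φ(y)
(`inner_sub_posPart_le`). The weak derivative prescribes the increments u(t) - u(s) = ∫ₛᵗ ∂ₜu in V*
for almost all s, t. Hence Φ(u(t)) - Φ(u(s)) ≥ ⟨∫ₛᵗ ∂ₜu, u⁺(s)⟩.

Take t = s + h and integrate over s in (a, b). The difference of the two sides is nonnegative for
small h of either sign and zero at h = 0, so its derivative there vanishes. Since translations are
continuous in L², this derivative is Φ(u(b)) - Φ(u(a)) - ∫ₐᵇ ⟨∂ₜu, u⁺⟩ at Lebesgue points a, b. This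
is `eq_integral_inner_of_subgradient`; it needs neither smooth approximation of u nor any regularity
of u⁺ in time beyond L².

With Φ = ½‖·‖² the same lemma gives the energy identity between Lebesgue points, then ‖u(t) - u(s)‖²
≤ 8 ∫ₛᵗ (‖∂ₜu‖² + ‖u‖²), and so the continuous representative (`exists_continuous_representative`).
Once u is continuous in H, the chain rule holds on all of [0, T] (`chain_rule_of_subgradient`).

It remains to see that u⁺ ∈ L²(I; V). The chain rule for √(s² + d²) - d, as d → 0, gives |v| the
weak gradient sign(v)∇v, so v⁺ = (v + |v|)/2 lies in V with ‖v⁺‖ ≤ ‖v‖. Measurability in V comes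
from measurability in H, because V → H is a continuous injection of a Polish space. -/

/-! ### Weak derivatives in time and primitives -/

/-- Primitive and test function are both absolutely continuous, so integration by parts applies; the
boundary terms vanish because the support lies in the open interval. -/
theorem hasWeakTimeDeriv_primitive_real {T : ℝ} (hT : 0 < T) {g : ℝ → ℝ}
    (hg : IntegrableOn g (Ioo 0 T)) (c : ℝ) :
    HasWeakTimeDeriv T (fun t => c + ∫ s in (0 : ℝ)..t, g s) g := by
  intro φ h1 h2 h3
  have hgi : IntervalIntegrable g volume 0 T := by
    rw [intervalIntegrable_iff_integrableOn_Ioo_of_le hT.le]; exact hg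
  have hAC := hgi.absolutelyContinuousOnInterval_intervalIntegral (c := 0) (by simp [hT.le])
  have hF : AbsolutelyContinuousOnInterval (fun t => c + ∫ s in (0 : ℝ)..t, g s) 0 T :=
    ((contDiff_const (c := c)).contDiffOn.absolutelyContinuousOnInterval).add hAC
  have hφ : AbsolutelyContinuousOnInterval φ 0 T :=
    (h1.of_le (by simp)).contDiffOn.absolutelyContinuousOnInterval
  have h := hφ.integral_mul_deriv_eq_deriv_mul hF
  have z0 : φ 0 = 0 := image_eq_zero_of_notMem_tsupport fun h => by simpa using h3 h
  have zT : φ T = 0 := image_eq_zero_of_notMem_tsupport fun h => by simpa using h3 h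
  rw [z0, zT, zero_mul, zero_mul, sub_zero, zero_sub] at h
  simp only [smul_eq_mul]
  rw [← integral_Ioc_eq_integral_Ioo, ← integral_Ioc_eq_integral_Ioo,
    ← intervalIntegral.integral_of_le hT.le, ← intervalIntegral.integral_of_le hT.le,
    ← neg_eq_iff_eq_neg, ← h]
  refine intervalIntegral.integral_congr_ae ?_
  filter_upwards [hgi.ae_hasDerivAt_integral] with x hx hxI
  rw [uIoc_of_le hT.le] at hxI
  rw [uIcc_of_le hT.le] at hx
  rw [((hx ⟨hxI.1.le, hxI.2⟩ 0 ⟨le_rfl, hT.le⟩).const_add c).deriv]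

theorem integrable_smul_of_hasCompactSupport {X : Type*} [NormedAddCommGroup X] [NormedSpace ℝ X]
    {μ : Measure ℝ} {f : ℝ → X} (hf : Integrable f μ) {φ : ℝ → ℝ} (h1 : Continuous φ)
    (h2 : HasCompactSupport φ) : Integrable (fun t => φ t • f t) μ := by
  obtain ⟨C, hC⟩ := h1.bounded_above_of_compact_support h2
  exact hf.bdd_smul C h1.aestronglyMeasurable (Eventually.of_forall hC)

theorem continuousOn_primitive_of_integrableOn {X : Type*} [NormedAddCommGroup X]
    [NormedSpace ℝ X] {T : ℝ} (hT : 0 < T) {g : ℝ → X} (hg : IntegrableOn g (Ioo 0 T)) :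
    ContinuousOn (fun t => ∫ s in (0 : ℝ)..t, g s) (Icc 0 T) :=
  intervalIntegral.continuousOn_primitive_interval (by
    rw [uIcc_of_le hT.le, integrableOn_Icc_iff_integrableOn_Ioo]; exact hg) |>.mono
    (by rw [uIcc_of_le hT.le])

/-- Continuous functionals separate points and commute with the integrals, which reduces the claim
to the scalar case. -/
theorem hasWeakTimeDeriv_primitive {X : Type*} [NormedAddCommGroup X] [NormedSpace ℝ X]
    [CompleteSpace X] {T : ℝ} (hT : 0 < T) {g : ℝ → X} (hg : IntegrableOn g (Ioo 0 T)) :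
    HasWeakTimeDeriv T (fun t => ∫ s in (0 : ℝ)..t, g s) g := by
  intro φ h1 h2 h3
  have hG : IntegrableOn (fun t => ∫ s in (0 : ℝ)..t, g s) (Ioo 0 T) :=
    ((continuousOn_primitive_of_integrableOn hT hg).integrableOn_compact isCompact_Icc).mono_set
      Ioo_subset_Icc_self
  rw [SeparatingDual.eq_iff_forall_dual_eq (R := ℝ)]
  intro ℓ
  have hd : Continuous (deriv φ) := h1.continuous_deriv (by simp)
  rw [map_neg, ← ℓ.integral_comp_comm (integrable_smul_of_hasCompactSupport hG hd h2.deriv),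
    ← ℓ.integral_comp_comm (integrable_smul_of_hasCompactSupport hg h1.continuous h2)]
  have h := hasWeakTimeDeriv_primitive_real hT (ℓ.integrable_comp hg) 0 φ h1 h2 h3
  simp only [zero_add, smul_eq_mul] at h
  simp only [map_smul, smul_eq_mul]
  rw [← h]
  refine setIntegral_congr_fun measurableSet_Ioo fun t ht => ?_
  rw [ℓ.intervalIntegral_comp_comm]
  rw [intervalIntegrable_iff_integrableOn_Ioo_of_le ht.1.le]
  exact hg.mono_set (Ioo_subset_Ioo_right ht.2.le)

/-- Mean zero is what makes the primitive vanish to the right of the support of `η`. -/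
theorem exists_primitive_test {T : ℝ} {η : ℝ → ℝ} (h1 : ContDiff ℝ ∞ η)
    (h2 : HasCompactSupport η) (h3 : tsupport η ⊆ Ioo 0 T) (h0 : ∫ t, η t = 0) :
    ∃ Φ : ℝ → ℝ, ContDiff ℝ ∞ Φ ∧ HasCompactSupport Φ ∧ tsupport Φ ⊆ Ioo 0 T ∧ deriv Φ = η := by
  have hd : ∀ t, HasDerivAt (fun t => ∫ s in (0 : ℝ)..t, η s) (η t) t := fun t =>
    h1.continuous.integral_hasStrictDerivAt 0 t |>.hasDerivAt
  have hderiv : deriv (fun t => ∫ s in (0 : ℝ)..t, η s) = η := funext fun t => (hd t).deriv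
  obtain ⟨a, b, hab, hK⟩ : ∃ a b, tsupport η ⊆ Icc a b ∧ Icc a b ⊆ Ioo 0 T := by
    rcases (tsupport η).eq_empty_or_nonempty with he | hne
    -- For empty support, the endpoints 1 > 0 give the empty interval.
    · exact ⟨1, 0, by simp [he], by simp⟩
    · obtain ⟨a, ha, ha'⟩ := h2.isCompact.exists_isLeast hne
      obtain ⟨b, hb, hb'⟩ := h2.isCompact.exists_isGreatest hne
      exact ⟨a, b, fun x hx => ⟨ha' hx, hb' hx⟩, fun x hx =>
        ⟨(h3 ha).1.trans_le hx.1, hx.2.trans_lt (h3 hb).2⟩⟩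
  have hη : ∀ t, t ∉ Icc a b → η t = 0 := fun t ht =>
    image_eq_zero_of_notMem_tsupport fun h => ht (hab h)
  have hη0 : ∀ t, t ∉ Ioo 0 T → η t = 0 := fun t ht => hη t fun h => ht (hK h)
  have hint : Integrable η := h1.continuous.integrable_of_hasCompactSupport h2
  have hsupp : Function.support (fun t => ∫ s in (0 : ℝ)..t, η s) ⊆ Icc a b := by
    intro t ht
    by_contra hn
    refine ht ?_
    simp only
    rcases lt_or_ge t a with hta | hta
    · refine intervalIntegral.integral_zero_ae (Eventually.of_forall fun s hs => ?_)
      rcases le_total 0 t with h | h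
      · rw [uIoc_of_le h] at hs
        exact hη s fun h' => by linarith [h'.1, hs.2]
      · rw [uIoc_of_ge h] at hs
        exact hη0 s fun h' => by linarith [h'.1, hs.2]
    · have htb : b < t := by by_contra! h; exact hn ⟨hta, h⟩
      have e : ∫ s in (0 : ℝ)..t, η s = ∫ s, η s := by
        rcases le_total 0 t with h | h
        · rw [intervalIntegral.integral_of_le h]
          refine setIntegral_eq_integral_of_forall_compl_eq_zero fun s hs => ?_
          by_contra hne
          have h4 : s ∈ Ioo 0 T := by by_contra h'; exact hne (hη0 s h')
          have h5 : s ∈ Icc a b := by by_contra h'; exact hne (hη s h')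
          exact hs ⟨h4.1, by linarith [h5.2]⟩
        · have hz : η = 0 := by
            funext s
            by_contra hne
            have h5 : s ∈ Icc a b := by by_contra h'; exact hne (hη s h')
            have := (hK h5).1
            linarith [h5.2]
          simp [hz]
      rw [e, h0]
  have hts : tsupport (fun t => ∫ s in (0 : ℝ)..t, η s) ⊆ Icc a b :=
    closure_minimal hsupp isClosed_Icc
  refine ⟨_, ?_, ?_, hts.trans hK, hderiv⟩
  · rw [contDiff_infty_iff_deriv, hderiv]
    exact ⟨fun t => (hd t).differentiableAt, h1⟩
  · exact isCompact_Icc.of_isClosed_subset (isClosed_tsupport _) hts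

/-- Du Bois-Reymond: for a fixed bump `ρ₀` of mass one, φ - (∫φ)ρ₀ has mean zero, so it is the
derivative of a test function and `f` annihilates it. Hence `f` acts on φ as the constant ∫ρ₀f. -/
theorem ae_eq_const_of_hasWeakTimeDeriv_zero {X : Type*} [NormedAddCommGroup X] [NormedSpace ℝ X]
    [CompleteSpace X] {T : ℝ} (hT : 0 < T) {f : ℝ → X} (hf : IntegrableOn f (Ioo 0 T))
    (h : HasWeakTimeDeriv T f 0) : ∃ c, ∀ᵐ t ∂(volume.restrict (Ioo 0 T)), f t = c := by
  let ρ : ContDiffBump (T / 2) := ⟨T / 8, T / 4, by positivity, by linarith⟩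
  set ρ₀ : ℝ → ℝ := ρ.normed volume with hρ₀
  have r1 : ContDiff ℝ ∞ ρ₀ := ρ.contDiff_normed
  have r2 : HasCompactSupport ρ₀ := ρ.hasCompactSupport_normed
  have r3 : tsupport ρ₀ ⊆ Ioo 0 T := by
    rw [hρ₀, ρ.tsupport_normed_eq, Real.closedBall_eq_Icc]
    intro x hx
    have h1 : T / 2 - T / 4 ≤ x := hx.1
    have h2 : x ≤ T / 2 + T / 4 := hx.2
    constructor <;> linarith
  have r4 : ∫ t, ρ₀ t = 1 := ρ.integral_normed
  refine ⟨∫ t in Ioo 0 T, ρ₀ t • f t, ?_⟩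
  set c := ∫ t in Ioo 0 T, ρ₀ t • f t with hc
  have key : ∀ᵐ t ∂(volume : Measure ℝ), t ∈ Ioo 0 T → f t - c = 0 := by
    have hfc : IntegrableOn (fun t => f t - c) (Ioo 0 T) := hf.sub (integrableOn_const (by simp))
    refine isOpen_Ioo.ae_eq_zero_of_integral_contDiff_smul_eq_zero hfc.locallyIntegrableOn
      fun φ p1 p2 p3 => ?_
    have hφi : Integrable φ := p1.continuous.integrable_of_hasCompactSupport p2
    have hρi : Integrable ρ₀ := r1.continuous.integrable_of_hasCompactSupport r2
    obtain ⟨Φ, q1, q2, q3, q4⟩ := exists_primitive_test (T := T)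
      (η := fun t => φ t - (∫ s, φ s) * ρ₀ t) (p1.sub (contDiff_const.mul r1))
      (p2.sub r2.mul_left)
      ((tsupport_sub _ _).trans (union_subset p3 ((tsupport_mul_subset_right).trans r3)))
      (by rw [integral_sub hφi (hρi.const_mul _), integral_const_mul, r4, mul_one, sub_self])
    have e := h Φ q1 q2 q3
    rw [q4] at e
    simp only [Pi.zero_apply, smul_zero, integral_zero, neg_zero, sub_smul, mul_smul] at e
    have i1 := integrable_smul_of_hasCompactSupport hf p1.continuous p2
    have i2 := integrable_smul_of_hasCompactSupport hf r1.continuous r2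
    have i3 : Integrable (fun t => (∫ s, φ s) • ρ₀ t • f t) (volume.restrict (Ioo 0 T)) :=
      i2.smul _
    rw [integral_sub i1 i3, integral_smul, ← hc] at e
    have hs : ∫ t, φ t • (f t - c) = ∫ t in Ioo 0 T, φ t • (f t - c) := by
      refine (setIntegral_eq_integral_of_forall_compl_eq_zero fun s hs => ?_).symm
      rw [image_eq_zero_of_notMem_tsupport fun h' => hs (p3 h'), zero_smul]
    have hs2 : ∫ t, φ t = ∫ t in Ioo 0 T, φ t := by
      refine (setIntegral_eq_integral_of_forall_compl_eq_zero fun s hs => ?_).symm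
      rw [image_eq_zero_of_notMem_tsupport fun h' => hs (p3 h')]
    rw [hs]
    simp only [smul_sub]
    rw [integral_sub i1 (hφi.integrableOn.smul_const c), integral_smul_const, ← hs2]
    exact e
  rw [ae_restrict_iff' measurableSet_Ioo]
  filter_upwards [key] with t ht hti
  exact sub_eq_zero.1 (ht hti)

theorem HasWeakTimeDeriv.exists_ae_eq_add_integral {X : Type*} [NormedAddCommGroup X]
    [NormedSpace ℝ X] [CompleteSpace X] {T : ℝ} (hT : 0 < T) {f g : ℝ → X}
    (hf : IntegrableOn f (Ioo 0 T)) (hg : IntegrableOn g (Ioo 0 T))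
    (h : HasWeakTimeDeriv T f g) :
    ∃ c, ∀ᵐ t ∂(volume.restrict (Ioo 0 T)), f t = c + ∫ s in (0 : ℝ)..t, g s := by
  have hG : IntegrableOn (fun t => ∫ s in (0 : ℝ)..t, g s) (Ioo 0 T) :=
    ((continuousOn_primitive_of_integrableOn hT hg).integrableOn_compact isCompact_Icc).mono_set
      Ioo_subset_Icc_self
  obtain ⟨c, hc⟩ := ae_eq_const_of_hasWeakTimeDeriv_zero hT
    (f := fun t => f t - ∫ s in (0 : ℝ)..t, g s) (hf.sub hG) (fun φ h1 h2 h3 => by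
      have hd : Continuous (deriv φ) := h1.continuous_deriv (by simp)
      simp only [smul_sub]
      rw [integral_sub (integrable_smul_of_hasCompactSupport hf hd h2.deriv)
        (integrable_smul_of_hasCompactSupport hG hd h2.deriv), h φ h1 h2 h3,
        hasWeakTimeDeriv_primitive hT hg φ h1 h2 h3]
      simp)
  refine ⟨c, ?_⟩
  filter_upwards [hc] with t ht
  rw [← ht, sub_add_cancel]

/-! ### Integrating a subgradient inequality -/

theorem MeasureTheory.MemLp.integrable_inner_real {α V : Type*} [MeasurableSpace α] {μ : Measure α}
    [NormedAddCommGroup V] [InnerProductSpace ℝ V] {f g : α → V} (hf : MemLp f 2 μ)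
    (hg : MemLp g 2 μ) : Integrable (fun x => ⟪f x, g x⟫) μ :=
  (hf.norm.integrable_mul hg.norm).mono (hf.1.inner hg.1) (Eventually.of_forall fun x => by
    simpa using abs_real_inner_le_norm (f x) (g x))

theorem MeasureTheory.LocallyIntegrable.intervalIntegrable {X : Type*} [NormedAddCommGroup X]
    {f : ℝ → X} (hf : LocallyIntegrable f) (a b : ℝ) : IntervalIntegrable f volume a b :=
  intervalIntegrable_iff.2
    ((hf.integrableOn_isCompact isCompact_uIcc).mono_set uIoc_subset_uIcc)

section Core

variable {V : Type*} [NormedAddCommGroup V] [InnerProductSpace ℝ V]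

/-- Translations act strongly continuously on L²; pairing with the fixed `q` preserves continuity.
-/
theorem continuous_integral_inner_translate {f q : ℝ → V} (hf : MemLp f 2 volume)
    (hq : MemLp q 2 volume) : Continuous fun r : ℝ => ∫ t, ⟪f (t + r), q t⟫ := by
  let g : C(ℝ, C(ℝ, ℝ)) :=
    (ContinuousMap.mk (fun z : ℝ × ℝ => z.2 + z.1) (by fun_prop)).curry
  have hg : ∀ r, MeasurePreserving (g r) (volume : Measure ℝ) volume := fun r =>
    measurePreserving_add_right volume r
  have hc : Continuous fun r => Lp.compMeasurePreserving (g r) (hg r) (hf.toLp f) :=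
    continuous_const.compMeasurePreservingLp g.continuous hg (by simp)
  have hi : Continuous fun r =>
      ⟪Lp.compMeasurePreserving (g r) (hg r) (hf.toLp f), hq.toLp q⟫ := hc.inner continuous_const
  refine hi.congr fun r => ?_
  rw [L2.inner_def]
  refine integral_congr_ae ?_
  filter_upwards [Lp.coeFn_compMeasurePreserving (hf.toLp f) (hg r), hq.coeFn_toLp,
    (hg r).quasiMeasurePreserving.ae_eq_comp hf.coeFn_toLp] with t h1 h2 h3
  rw [h1, h2, h3]
  rfl

/-- Fubini. The averaged increments become the primitive of a continuous function of the shift, so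
they can be differentiated at h = 0. -/
theorem integral_inner_translate_eq [CompleteSpace V] {f p : ℝ → V} (hf : MemLp f 2 volume)
    (hp : MemLp p 2 volume) {a b : ℝ} (hab : a ≤ b) (h : ℝ) :
    ∫ r in (0 : ℝ)..h, ∫ t, ⟪f (t + r), (Ioc a b).indicator p t⟫
      = ∫ t in a..b, ⟪∫ s in t..(t + h), f s, p t⟫ := by
  have hloc : LocallyIntegrable f := hf.locallyIntegrable (by norm_num)
  have hq : MemLp ((Ioc a b).indicator p) 2 volume := hp.indicator measurableSet_Ioc
  have : IsFiniteMeasure ((volume : Measure ℝ).restrict (uIoc 0 h)) := ⟨by simp [uIoc]⟩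
  rw [intervalIntegral_integral_swap (f := fun r t => ⟪f (t + r), (Ioc a b).indicator p t⟫)]
  · have e : ∀ t, ∫ r in (0 : ℝ)..h, ⟪f (t + r), (Ioc a b).indicator p t⟫
        = (Ioc a b).indicator (fun t => ⟪∫ s in t..(t + h), f s, p t⟫) t := by
      intro t
      have h1 : IntervalIntegrable (fun r => f (t + r)) volume 0 h := by
        have := (hloc.intervalIntegrable t (t + h)).comp_add_left t
        simpa using this
      have h2 := ((innerSL ℝ (E := V)).flip ((Ioc a b).indicator p t)).intervalIntegral_comp_comm h1
      simp only [ContinuousLinearMap.flip_apply, innerSL_apply_apply] at h2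
      rw [h2, intervalIntegral.integral_comp_add_left (f := f), add_zero]
      by_cases ht : t ∈ Ioc a b <;> simp [ht]
    simp_rw [e]
    rw [integral_indicator measurableSet_Ioc, intervalIntegral.integral_of_le hab]
  -- Joint square integrability: the shear (r, t) ↦ (r, r + t) preserves the product measure, and
  -- the r-interval has finite measure.
  · refine MemLp.integrable_inner_real (f := fun z : ℝ × ℝ => f (z.2 + z.1)) ?_ (hq.comp_snd _)
    have := (hf.comp_snd (volume.restrict (uIoc 0 h))).comp_measurePreserving
      (measurePreserving_prod_add (volume.restrict (uIoc 0 h)) volume)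
    simpa [Function.comp_def, add_comm] using this

/-- If `ψ t - ψ s ≥ ⟪∫ₛᵗ f, p s⟫` for almost all `s, t`, then `⟪f, p⟫` integrates to the increment
of `ψ` between Lebesgue points. -/
theorem eq_integral_inner_of_subgradient [CompleteSpace V] {T : ℝ} {f p : ℝ → V}
    (hf : MemLp f 2 volume) (hp : MemLp p 2 volume) {ψ : ℝ → ℝ} (hψ : IntegrableOn ψ (Ioo 0 T))
    {S : Set ℝ} (hS : ∀ᵐ t ∂(volume.restrict (Ioo 0 T)), t ∈ S)
    (hsub : ∀ s ∈ S, ∀ t ∈ S, ⟪∫ r in s..t, f r, p s⟫ ≤ ψ t - ψ s) {a b : ℝ} (ha : 0 < a)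
    (hab : a < b) (hb : b < T) (hda : HasDerivAt (fun x => ∫ t in (0 : ℝ)..x, ψ t) (ψ a) a)
    (hdb : HasDerivAt (fun x => ∫ t in (0 : ℝ)..x, ψ t) (ψ b) b) :
    ψ b - ψ a = ∫ t in a..b, ⟪f t, p t⟫ := by
  have hloc : LocallyIntegrable f := hf.locallyIntegrable (by norm_num)
  have hploc : LocallyIntegrable p := hp.locallyIntegrable (by norm_num)
  set K : ℝ → ℝ := fun r => ∫ t, ⟪f (t + r), (Ioc a b).indicator p t⟫ with hK
  have hKc : Continuous K :=
    continuous_integral_inner_translate hf (hp.indicator measurableSet_Ioc)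
  have hK0 : K 0 = ∫ t in a..b, ⟪f t, p t⟫ := by
    rw [intervalIntegral.integral_of_le hab.le, ← integral_indicator measurableSet_Ioc, hK]
    refine integral_congr_ae (Eventually.of_forall fun t => ?_)
    by_cases ht : t ∈ Ioc a b <;> simp [ht]
  have hψi : ∀ {x y}, 0 ≤ x → 0 ≤ y → x ≤ T → y ≤ T → IntervalIntegrable ψ volume x y := by
    intro x y hx hy hx' hy'
    have hT : 0 ≤ T := hx.trans hx'
    have h1 : IntervalIntegrable ψ volume 0 T := by
      rw [intervalIntegrable_iff_integrableOn_Ioo_of_le hT]; exact hψ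
    exact h1.mono_set (by
      rw [uIcc_of_le hT]
      exact uIcc_subset_Icc ⟨hx, hx'⟩ ⟨hy, hy'⟩)
  have hA : HasDerivAt (fun h => (∫ t in (0 : ℝ)..(b + h), ψ t) - (∫ t in (0 : ℝ)..(a + h), ψ t)
      - ∫ r in (0 : ℝ)..h, K r) (ψ b - ψ a - K 0) 0 := by
    refine (HasDerivAt.sub ?_ ?_).sub ?_
    · exact HasDerivAt.comp_const_add b 0 (by simpa using hdb)
    · exact HasDerivAt.comp_const_add a 0 (by simpa using hda)
    · exact (hKc.integral_hasStrictDerivAt 0 0).hasDerivAt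
  rw [← hK0]
  -- Up to the constant ∫ₐᵇ ψ, the function in `hA` is the integrated difference of the two sides of
  -- the subgradient inequality. It is minimal at h = 0; shifts of both signs are what turn the
  -- inequality into an equality.
  refine sub_eq_zero.1 (IsLocalMin.hasDerivAt_eq_zero ?_ hA)
  have hnear : ∀ᶠ h in 𝓝 (0 : ℝ), 0 < a + h ∧ b + h < T := by
    refine Filter.Eventually.and ?_ ?_
    · exact (by fun_prop : Continuous fun h : ℝ => a + h).continuousAt.eventually_const_lt
        (by simpa using ha)
    · exact (by fun_prop : Continuous fun h : ℝ => b + h).continuousAt.eventually_lt_const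
        (by simpa using hb)
  filter_upwards [hnear] with h hh
  have i1 : IntervalIntegrable (fun t => ψ (t + h)) volume a b := by
    have := (hψi (x := a + h) (y := b + h) hh.1.le (by linarith) (by linarith) hh.2.le)
      |>.comp_add_right h
    simpa using this
  have i2 : IntervalIntegrable ψ volume a b := hψi ha.le (by linarith) (by linarith) hb.le
  have hF : Continuous fun t => ∫ s in t..(t + h), f s := by
    have h0 : Continuous fun t => ∫ s in (0 : ℝ)..t, f s :=
      intervalIntegral.continuous_primitive (fun x y => hloc.intervalIntegrable x y) 0
    have h1 : Continuous fun t => (∫ s in (0 : ℝ)..(t + h), f s) - ∫ s in (0 : ℝ)..t, f s :=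
      (h0.comp (continuous_id.add continuous_const)).sub h0
    refine h1.congr fun t => ?_
    exact intervalIntegral.integral_interval_sub_left (hloc.intervalIntegrable _ _)
      (hloc.intervalIntegrable _ _)
  have i3 : IntervalIntegrable (fun t => ⟪∫ s in t..(t + h), f s, p t⟫) volume a b := by
    rw [intervalIntegrable_iff_integrableOn_Icc_of_le hab.le]
    obtain ⟨C, hC⟩ := isCompact_Icc.exists_bound_of_continuousOn (hF.continuousOn (s := Icc a b))
    have hpI : IntegrableOn p (Icc a b) := hploc.integrableOn_isCompact isCompact_Icc
    refine (hpI.norm.const_mul C).mono' (hF.aestronglyMeasurable.inner hpI.1) ?_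
    rw [ae_restrict_iff' measurableSet_Icc]
    refine Eventually.of_forall fun t ht => (norm_inner_le_norm _ _).trans ?_
    exact mul_le_mul_of_nonneg_right (hC t ht) (norm_nonneg _)
  have eA : (∫ t in (0 : ℝ)..(b + h), ψ t) - (∫ t in (0 : ℝ)..(a + h), ψ t)
      - ((∫ t in (0 : ℝ)..b, ψ t) - ∫ t in (0 : ℝ)..a, ψ t)
      = ∫ t in a..b, (ψ (t + h) - ψ t) := by
    rw [intervalIntegral.integral_sub i1 i2, intervalIntegral.integral_comp_add_right (f := ψ),
      intervalIntegral.integral_interval_sub_left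
        (hψi le_rfl (by linarith) (by linarith) (by linarith))
        (hψi le_rfl (by linarith) (by linarith) (by linarith)),
      intervalIntegral.integral_interval_sub_left
        (hψi le_rfl (by linarith) (by linarith) (by linarith))
        (hψi le_rfl (by linarith) (by linarith) (by linarith))]
  have hle : ∫ r in (0 : ℝ)..h, K r ≤ ∫ t in a..b, (ψ (t + h) - ψ t) := by
    rw [hK, integral_inner_translate_eq hf hp hab.le]
    refine intervalIntegral.integral_mono_ae_restrict hab.le i3 (i1.sub i2) ?_
    rw [ae_restrict_iff' measurableSet_Ioo] at hS
    -- Translation preserves null sets, so t and t + h are both good times for almost every t.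
    have hS' := (measurePreserving_add_right volume h).quasiMeasurePreserving.ae hS
    rw [EventuallyLE, ae_restrict_iff' measurableSet_Icc]
    filter_upwards [hS, hS'] with t h1 h2 ht
    exact hsub t (h1 ⟨by linarith [ht.1], by linarith [ht.2]⟩) (t + h)
      (h2 ⟨by linarith [ht.1], by linarith [ht.2]⟩)
  simp only [add_zero, intervalIntegral.integral_same, sub_zero]
  linarith

end Core

/-! ### The continuous representative and the chain rule in time -/

theorem Icc_subset_closure_of_ae_mem {T : ℝ} (hT : 0 < T) {S : Set ℝ}
    (hS : ∀ᵐ t ∂(volume.restrict (Ioo 0 T)), t ∈ S) : Icc 0 T ⊆ closure (Ioo 0 T ∩ S) := by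
  rw [ae_restrict_iff' measurableSet_Ioo] at hS
  have hd : Dense {t | t ∈ Ioo 0 T → t ∈ S} := Measure.dense_of_ae hS
  have h1 : Ioo 0 T ⊆ closure (Ioo 0 T ∩ S) :=
    (hd.open_subset_closure_inter isOpen_Ioo).trans
      (closure_mono fun t ht => ⟨ht.1, ht.2 ht.1⟩)
  rw [← closure_Ioo hT.ne]
  exact closure_minimal h1 isClosed_closure

/-- Continuity of `F` makes `g` Cauchy along `S` at each point of the closure, so `g` extends by
limits. -/
theorem exists_continuousOn_extension {H : Type*} [NormedAddCommGroup H] [CompleteSpace H]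
    {T : ℝ} {g : ℝ → H} {F : ℝ → ℝ}
    {S : Set ℝ} (hcl : Icc 0 T ⊆ closure S) (hF : Continuous F)
    (hbd : ∀ s ∈ S, ∀ t ∈ S, ‖g t - g s‖ ^ 2 ≤ 8 * |F t - F s|) :
    ∃ gb : ℝ → H, ContinuousOn gb (Icc 0 T) ∧ ∀ t ∈ S, gb t = g t := by
  have hlim : ∀ x ∈ closure S, ∃ y, Tendsto g (𝓝[S] x) (𝓝 y) := by
    intro x hx
    have hne : (𝓝[S] x).NeBot := mem_closure_iff_nhdsWithin_neBot.1 hx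
    rw [← cauchy_map_iff_exists_tendsto, Metric.cauchy_iff]
    refine ⟨hne.map g, fun ε hε => ?_⟩
    -- The radius ε²/32 yields ‖g s - g t‖² ≤ 8 · ε²/16 < ε².
    have hU : ∀ᶠ t in 𝓝[S] x, t ∈ S ∧ |F t - F x| < ε ^ 2 / 32 := by
      refine Filter.Eventually.and self_mem_nhdsWithin (nhdsWithin_le_nhds ?_)
      have := Metric.tendsto_nhds.1 (hF.tendsto x) (ε ^ 2 / 32) (by positivity)
      simp only [Real.dist_eq] at this
      exact this
    refine ⟨g '' {t | t ∈ S ∧ |F t - F x| < ε ^ 2 / 32}, image_mem_map hU, ?_⟩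
    rintro _ ⟨s, hs, rfl⟩ _ ⟨t, ht, rfl⟩
    rw [dist_eq_norm]
    have h1 := hbd t ht.1 s hs.1
    have h2 : |F s - F t| < ε ^ 2 / 16 := by
      have a1 := abs_lt.1 hs.2
      have a2 := abs_lt.1 ht.2
      rw [abs_lt]
      constructor <;> linarith
    refine lt_of_pow_lt_pow_left₀ 2 hε.le ?_
    nlinarith
  refine ⟨extendFrom S g, continuousOn_extendFrom hcl fun x hx => hlim x (hcl hx), fun t ht => ?_⟩
  obtain ⟨y, hy⟩ := hlim t (subset_closure ht)
  rw [extendFrom_eq (subset_closure ht) hy]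
  exact (tendsto_nhds_unique (tendsto_pure_nhds g t) (hy.mono_left (pure_le_nhdsWithin ht))).symm

section Triple

variable {V H : Type*} [NormedAddCommGroup V] [InnerProductSpace ℝ V] [CompleteSpace V]
  [NormedAddCommGroup H] [InnerProductSpace ℝ H]

/-- A function satisfying the energy identity is `1/2`-Hölder, away from a null set, with respect
to the measure with density `‖f‖² + ‖u‖²`. -/
theorem norm_sub_sq_le_of_energy {ι : V →L[ℝ] H} {u f : ℝ → V} (hu : MemLp u 2 volume)
    (hf : MemLp f 2 volume) {S : Set ℝ}
    (hdiff : ∀ s ∈ S, ∀ t ∈ S, ∀ v, ⟪ι (u t) - ι (u s), ι v⟫ = ⟪∫ r in s..t, f r, v⟫)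
    (henergy : ∀ s ∈ S, ∀ t ∈ S,
      2⁻¹ * ‖ι (u t)‖ ^ 2 - 2⁻¹ * ‖ι (u s)‖ ^ 2 = ∫ r in s..t, ⟪f r, u r⟫)
    {a b : ℝ} (hab : a < b) (ha : a ∈ S) (hb : b ∈ S)
    (hS : ∀ᵐ t ∂(volume.restrict (Ioo a b)), t ∈ S) :
    ‖ι (u b) - ι (u a)‖ ^ 2 ≤ 8 * ∫ t in a..b, (‖f t‖ ^ 2 + ‖u t‖ ^ 2) := by
  have hloc : LocallyIntegrable f := hf.locallyIntegrable (by norm_num)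
  have hu2 : Integrable fun t => ‖u t‖ ^ 2 := hu.integrable_norm_pow (by norm_num)
  have hf2 : Integrable fun t => ‖f t‖ ^ 2 := hf.integrable_norm_pow (by norm_num)
  -- A good time `c` where ‖u‖² is at most its mean, so that (b - a)‖u c‖² ≤ ∫ₐᵇ ‖u‖². This stands
  -- in for a pointwise bound on ‖u‖ in V.
  obtain ⟨c, hcN, hc⟩ := exists_notMem_null_le_average (μ := volume.restrict (Ioo a b))
    (N := {t | ¬ (t ∈ S ∧ t ∈ Ioo a b)}) (f := fun t => ‖u t‖ ^ 2)
    (by rw [Ne, Measure.restrict_eq_zero]; simp [hab]) hu2.integrableOn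
    (ae_iff.1 (hS.and (ae_restrict_mem measurableSet_Ioo)))
  obtain ⟨hcS, hcI⟩ := not_not.1 hcN
  rw [setAverage_eq, Real.volume_real_Ioo_of_le hab.le, smul_eq_mul, ← integral_Ioc_eq_integral_Ioo,
    ← div_eq_inv_mul, le_div_iff₀ (sub_pos.2 hab)] at hc
  have e2 : ∫ t in a..b, (‖f t‖ ^ 2 + ‖u t‖ ^ 2)
      = (∫ t in Ioc a b, ‖f t‖ ^ 2) + ∫ t in Ioc a b, ‖u t‖ ^ 2 := by
    rw [intervalIntegral.integral_of_le hab.le, integral_add hf2.integrableOn hu2.integrableOn]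
  have key : ∀ y ∈ S, y ∈ Icc a b →
      ‖ι (u y) - ι (u c)‖ ^ 2 ≤ 2 * ∫ t in a..b, (‖f t‖ ^ 2 + ‖u t‖ ^ 2) := by
    intro y hy hyI
    -- From ‖x - y‖² = ‖x‖² - ‖y‖² - 2⟨x - y, y⟩: the energy identity evaluates the first
    -- difference, the increment formula the last term.
    have h1 : ‖ι (u y) - ι (u c)‖ ^ 2 = ∫ r in c..y, (2 * ⟪f r, u r⟫ - 2 * ⟪f r, u c⟫) := by
      have i1 : IntervalIntegrable (fun r => ⟪f r, u r⟫) volume c y :=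
        (hf.integrable_inner_real hu).intervalIntegrable
      have i0 : IntervalIntegrable f volume c y := hloc.intervalIntegrable c y
      have i2 : IntervalIntegrable (fun r => ⟪f r, u c⟫) volume c y :=
        ⟨i0.1.inner_const _, i0.2.inner_const _⟩
      have h2 := ((innerSL ℝ (E := V)).flip (u c)).intervalIntegral_comp_comm i0
      simp only [ContinuousLinearMap.flip_apply, innerSL_apply_apply] at h2
      rw [intervalIntegral.integral_sub (i1.const_mul 2) (i2.const_mul 2),
        intervalIntegral.integral_const_mul, intervalIntegral.integral_const_mul,
        ← henergy c hcS y hy, h2, ← hdiff c hcS y hy, norm_sub_sq_real, inner_sub_left,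
        real_inner_self_eq_norm_sq]
      ring
    have i3 : IntegrableOn (fun r => 2 * ‖f r‖ ^ 2 + ‖u r‖ ^ 2 + ‖u c‖ ^ 2) (Ioc a b) :=
      ((hf2.const_mul 2).add hu2).integrableOn.add (integrableOn_const (by simp))
    have hsub : uIoc c y ⊆ Ioc a b := by
      intro t ht
      rw [mem_uIoc] at ht
      rcases ht with ht | ht
      · exact ⟨hcI.1.trans ht.1, ht.2.trans hyI.2⟩
      · exact ⟨hyI.1.trans_lt ht.1, ht.2.trans hcI.2.le⟩
    have h3 : ‖∫ r in c..y, (2 * ⟪f r, u r⟫ - 2 * ⟪f r, u c⟫)‖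
        ≤ ∫ r in Ioc a b, (2 * ‖f r‖ ^ 2 + ‖u r‖ ^ 2 + ‖u c‖ ^ 2) := by
      refine intervalIntegral.norm_integral_le_integral_norm_uIoc.trans ?_
      have h4 : ∀ r, ‖2 * ⟪f r, u r⟫ - 2 * ⟪f r, u c⟫‖
          ≤ 2 * ‖f r‖ ^ 2 + ‖u r‖ ^ 2 + ‖u c‖ ^ 2 := by
        intro r
        have j1 := abs_le.1 (abs_real_inner_le_norm (f r) (u r))
        have j2 := abs_le.1 (abs_real_inner_le_norm (f r) (u c))
        rw [Real.norm_eq_abs, abs_le]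
        constructor <;>
          nlinarith [sq_nonneg (‖f r‖ - ‖u r‖), sq_nonneg (‖f r‖ - ‖u c‖)]
      refine (integral_mono_of_nonneg (Eventually.of_forall fun r => norm_nonneg _)
        (i3.mono_set hsub) (Eventually.of_forall h4)).trans ?_
      exact setIntegral_mono_set i3
        (Eventually.of_forall fun r => by simp only [Pi.zero_apply]; positivity)
        (LE.le.eventuallyLE hsub)
    rw [← h1] at h3
    have i4 : IntegrableOn (fun r => 2 * ‖f r‖ ^ 2 + ‖u r‖ ^ 2) (Ioc a b) :=
      ((hf2.const_mul 2).add hu2).integrableOn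
    rw [integral_add i4 (integrableOn_const (by simp)),
      integral_add (hf2.const_mul 2).integrableOn hu2.integrableOn, integral_const_mul,
      setIntegral_const, Real.volume_real_Ioc_of_le hab.le, smul_eq_mul] at h3
    rw [e2]
    have := (le_abs_self _).trans h3
    nlinarith
  have kb := key b hb ⟨hab.le, le_rfl⟩
  have ka := key a ha ⟨le_rfl, hab.le⟩
  have tri : ‖ι (u b) - ι (u a)‖ ≤ ‖ι (u b) - ι (u c)‖ + ‖ι (u a) - ι (u c)‖ := by
    rw [norm_sub_rev (ι (u a))]
    exact norm_sub_le_norm_sub_add_norm_sub _ _ _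
  -- The constant 8: (p + q)² ≤ 2p² + 2q², and each square is at most twice the integral.
  nlinarith [norm_nonneg (ι (u b) - ι (u a)),
    sq_nonneg (‖ι (u b) - ι (u c)‖ - ‖ι (u a) - ι (u c)‖)]

/-- The identity is a subgradient of ½‖·‖², which yields the energy identity before any continuity
is known. The resulting modulus of continuity on a set of full measure permits extension to [0, T].
-/
theorem exists_continuous_representative [CompleteSpace H] {T : ℝ} (hT : 0 < T) {ι : V →L[ℝ] H}
    {u f : ℝ → V} (hu : MemLp u 2 volume) (hf : MemLp f 2 volume) {S : Set ℝ}
    (hS : ∀ᵐ t ∂(volume.restrict (Ioo 0 T)), t ∈ S)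
    (hdiff : ∀ s ∈ S, ∀ t ∈ S, ∀ v, ⟪ι (u t) - ι (u s), ι v⟫ = ⟪∫ r in s..t, f r, v⟫) :
    ∃ ub : ℝ → H, ContinuousOn ub (Icc 0 T) ∧
      ∀ᵐ t ∂(volume.restrict (Ioo 0 T)), ub t = ι (u t) := by
  set ψ : ℝ → ℝ := fun t => 2⁻¹ * ‖ι (u t)‖ ^ 2 with hψ
  have hψi : Integrable ψ := ((ι.comp_memLp' hu).integrable_norm_pow (by norm_num)).const_mul 2⁻¹
  -- Lebesgue points of ψ, where its primitive has derivative ψ; ψ itself is not yet known to be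
  -- continuous.
  set S' : Set ℝ := Ioo 0 T ∩
    {t | t ∈ S ∧ HasDerivAt (fun x => ∫ t in (0 : ℝ)..x, ψ t) (ψ t) t} with hS'
  have haeS : ∀ᵐ t ∂(volume.restrict (Ioo 0 T)),
      t ∈ S ∧ HasDerivAt (fun x => ∫ t in (0 : ℝ)..x, ψ t) (ψ t) t := by
    filter_upwards [hS, ae_restrict_of_ae 
        (_root_.LocallyIntegrable.ae_hasDerivAt_integral hψi.locallyIntegrable)]
      with t h1 h2 using ⟨h1, h2 0⟩
  have haeS' : ∀ᵐ t ∂(volume.restrict (Ioo 0 T)), t ∈ S' := by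
    filter_upwards [haeS, ae_restrict_mem measurableSet_Ioo] with t h1 h2 using ⟨h2, h1⟩
  have hsub : ∀ s ∈ S, ∀ t ∈ S, ⟪∫ r in s..t, f r, u s⟫ ≤ ψ t - ψ s := by
    intro s hs t ht
    rw [← hdiff s hs t ht, hψ, inner_sub_left, real_inner_self_eq_norm_sq]
    have := real_inner_le_norm (ι (u t)) (ι (u s))
    nlinarith [sq_nonneg (‖ι (u t)‖ - ‖ι (u s)‖)]
  have hlt : ∀ s ∈ S', ∀ t ∈ S', s < t → ψ t - ψ s = ∫ r in s..t, ⟪f r, u r⟫ :=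
    fun s hs t ht hst => eq_integral_inner_of_subgradient hf hu hψi.integrableOn hS hsub hs.1.1 hst
      ht.1.2 hs.2.2 ht.2.2
  have henergy : ∀ s ∈ S', ∀ t ∈ S', ψ t - ψ s = ∫ r in s..t, ⟪f r, u r⟫ := by
    intro s hs t ht
    rcases lt_trichotomy s t with h | h | h
    · exact hlt s hs t ht h
    · subst h; simp
    · rw [intervalIntegral.integral_symm, ← hlt t ht s hs h]; ring
  have hu2 : Integrable fun t => ‖u t‖ ^ 2 := hu.integrable_norm_pow (by norm_num)
  have hf2 : Integrable fun t => ‖f t‖ ^ 2 := hf.integrable_norm_pow (by norm_num)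
  have he : Integrable fun t => ‖f t‖ ^ 2 + ‖u t‖ ^ 2 := hf2.add hu2
  set F : ℝ → ℝ := fun t => ∫ s in (0 : ℝ)..t, (‖f s‖ ^ 2 + ‖u s‖ ^ 2) with hF
  have hbd' : ∀ s ∈ S', ∀ t ∈ S', s < t → ‖ι (u t) - ι (u s)‖ ^ 2 ≤ 8 * |F t - F s| := by
    intro s hs t ht hst
    have h1 := norm_sub_sq_le_of_energy (ι := ι) hu hf (S := S')
      (fun s hs t ht => hdiff s hs.2.1 t ht.2.1) henergy hst hs ht
      (ae_restrict_of_ae_restrict_of_subset (Ioo_subset_Ioo hs.1.1.le ht.1.2.le) haeS')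
    rw [hF, intervalIntegral.integral_interval_sub_left he.intervalIntegrable
      he.intervalIntegrable]
    exact h1.trans (mul_le_mul_of_nonneg_left (le_abs_self _) (by norm_num))
  obtain ⟨ub, h1, h2⟩ := exists_continuousOn_extension (T := T) (g := fun t => ι (u t)) (F := F)
    (S := S') (Icc_subset_closure_of_ae_mem hT haeS)
    (intervalIntegral.continuous_primitive (fun _ _ => he.intervalIntegrable) 0) (by
      intro s hs t ht
      rcases lt_trichotomy s t with h | h | h
      · exact hbd' s hs t ht h
      · subst h; simp
      · rw [norm_sub_rev, abs_sub_comm]; exact hbd' t ht s hs h)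
  exact ⟨ub, h1, haeS'.mono h2⟩

/-- The chain rule `Φ(u(t)) = Φ(u(0)) + ∫₀ᵗ ⟨∂ₜu, DΦ(u)⟩` for a functional `Φ` on the pivot space
with subgradient `D`. -/
theorem chain_rule_of_subgradient {T : ℝ} (hT : 0 < T) {ι : V →L[ℝ] H} {u f p : ℝ → V}
    (hf : MemLp f 2 volume) (hp : MemLp p 2 volume) {S : Set ℝ}
    (hS : ∀ᵐ t ∂(volume.restrict (Ioo 0 T)), t ∈ S)
    (hdiff : ∀ s ∈ S, ∀ t ∈ S, ∀ v, ⟪ι (u t) - ι (u s), ι v⟫ = ⟪∫ r in s..t, f r, v⟫)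
    {ub : ℝ → H} (hub : ContinuousOn ub (Icc 0 T))
    (hubu : ∀ᵐ t ∂(volume.restrict (Ioo 0 T)), ub t = ι (u t)) {Φ : H → ℝ} (hΦ : Continuous Φ)
    {D : H → H} (hD : ∀ x y, ⟪x - y, D y⟫ ≤ Φ x - Φ y)
    (hpD : ∀ᵐ t ∂(volume.restrict (Ioo 0 T)), ι (p t) = D (ι (u t))) :
    ∀ t ∈ Icc 0 T, Φ (ub t) = Φ (ub 0) + ∫ r in (0 : ℝ)..t, ⟪f r, p r⟫ := by
  have hψ : ContinuousOn (fun t => Φ (ub t)) (Icc 0 T) := hΦ.comp_continuousOn hub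
  have hψi : IntegrableOn (fun t => Φ (ub t)) (Ioo 0 T) :=
    (hψ.integrableOn_compact isCompact_Icc).mono_set Ioo_subset_Icc_self
  have hae : ∀ᵐ t ∂(volume.restrict (Ioo 0 T)),
      t ∈ {t | t ∈ S ∧ ub t = ι (u t) ∧ ι (p t) = D (ι (u t))} := hS.and (hubu.and hpD)
  -- Now that `ub` is continuous, every interior time is a Lebesgue point.
  have hder : ∀ a ∈ Ioo 0 T,
      HasDerivAt (fun x => ∫ t in (0 : ℝ)..x, Φ (ub t)) (Φ (ub a)) a := by
    intro a ha
    refine intervalIntegral.integral_hasDerivAt_right ?_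
      ((hψ.mono Ioo_subset_Icc_self).stronglyMeasurableAtFilter isOpen_Ioo a ha)
      (hψ.continuousAt (Icc_mem_nhds ha.1 ha.2))
    rw [intervalIntegrable_iff_integrableOn_Ioo_of_le ha.1.le]
    exact hψi.mono_set (Ioo_subset_Ioo_right ha.2.le)
  have hlt : ∀ a ∈ Ioo 0 T, ∀ b ∈ Ioo 0 T, a < b →
      Φ (ub b) - Φ (ub a) = ∫ t in a..b, ⟪f t, p t⟫ := by
    intro a ha b hb hab
    refine eq_integral_inner_of_subgradient (ψ := fun t => Φ (ub t)) hf hp hψi hae ?_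
      ha.1 hab hb.2 (hder a ha) (hder b hb)
    rintro s ⟨s1, s2, s3⟩ t ⟨t1, t2, -⟩
    rw [← hdiff s s1 t t1, s3, s2, t2]
    exact hD _ _
  have hint : Integrable fun t => ⟪f t, p t⟫ := hf.integrable_inner_real hp
  have hGc : ContinuousOn (fun t => Φ (ub t) - ∫ r in (0 : ℝ)..t, ⟪f r, p r⟫) (Icc 0 T) :=
    hψ.sub (intervalIntegral.continuous_primitive (fun _ _ => hint.intervalIntegrable) 0).continuousOn
  have hhalf : T / 2 ∈ Ioo 0 T := ⟨by linarith, by linarith⟩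
  have hG : EqOn (fun t => Φ (ub t) - ∫ r in (0 : ℝ)..t, ⟪f r, p r⟫)
      (fun _ => Φ (ub (T / 2)) - ∫ r in (0 : ℝ)..(T / 2), ⟪f r, p r⟫) (Icc 0 T) := by
    -- The identity on the open interval reaches the endpoints 0 and T by continuity.
    refine EqOn.of_subset_closure (s := Ioo 0 T) (fun t ht => ?_) hGc continuousOn_const
      Ioo_subset_Icc_self (by rw [closure_Ioo hT.ne])
    have hsplit := intervalIntegral.integral_interval_sub_left (μ := volume)
      (f := fun r => ⟪f r, p r⟫) (a := 0) (b := t) (c := T / 2) hint.intervalIntegrable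
      hint.intervalIntegrable
    change Φ (ub t) - _ = Φ (ub (T / 2)) - _
    rcases lt_trichotomy t (T / 2) with h | h | h
    · have := hlt t ht _ hhalf h
      rw [intervalIntegral.integral_symm] at this
      linarith
    · rw [h]
    · have := hlt _ hhalf t ht h
      linarith
  intro t ht
  have h1 := (hG ht).trans (hG ⟨le_rfl, hT.le⟩).symm
  simp only [intervalIntegral.integral_same, sub_zero] at h1
  linarith

end Triple

/-! ### Mollification in L¹ -/

section Mollifier

variable {E : Type*} [NormedAddCommGroup E] [NormedSpace ℝ E] [FiniteDimensional ℝ E]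
  [MeasurableSpace E] [BorelSpace E] {μ : Measure E} [μ.IsAddHaarMeasure]

/-- Pointwise |ρ ⋆ h| ≤ ρ ⋆ |h|, and convolution with a kernel of mass one preserves the integral.
-/
theorem ContDiffBump.integral_abs_normed_convolution_le (ρ : ContDiffBump (0 : E)) {h : E → ℝ}
    (hh : Integrable h μ) :
    ∫ x, |(ρ.normed μ ⋆[ContinuousLinearMap.lsmul ℝ ℝ, μ] h) x| ∂μ ≤ ∫ x, |h x| ∂μ := by
  have e : ∫ x, (ρ.normed μ ⋆[ContinuousLinearMap.lsmul ℝ ℝ, μ] fun y => |h y|) x ∂μ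
      = ∫ x, |h x| ∂μ := by
    rw [integral_convolution _ ρ.integrable_normed hh.abs, ρ.integral_normed]
    simp
  rw [← e]
  refine integral_mono_of_nonneg (Eventually.of_forall fun x => abs_nonneg _)
    (ρ.integrable_normed.integrable_convolution _ hh.abs) (Eventually.of_forall fun x => ?_)
  simp only [convolution_def, ContinuousLinearMap.lsmul_apply, smul_eq_mul]
  refine (abs_integral_le_integral_abs).trans (le_of_eq ?_)
  refine integral_congr_ae (Eventually.of_forall fun t => ?_)
  simp only [abs_mul, abs_of_nonneg (ρ.nonneg_normed t)]

/-- Uniform continuity makes the difference uniformly small, and for radii below 1 it vanishes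
outside the compact 1-thickening of the support. -/
theorem ContDiffBump.tendsto_integral_abs_convolution_sub_of_continuous
    {ρ : ℕ → ContDiffBump (0 : E)} (hρ : Tendsto (fun k => (ρ k).rOut) atTop (𝓝 0)) {g : E → ℝ}
    (hg : Continuous g) (hgc : HasCompactSupport g) :
    Tendsto (fun k => ∫ x,
      |((ρ k).normed μ ⋆[ContinuousLinearMap.lsmul ℝ ℝ, μ] g) x - g x| ∂μ) atTop (𝓝 0) := by
  set L : Set E := Metric.cthickening 1 (tsupport g) with hL
  have hLc : IsCompact L := hgc.isCompact.cthickening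
  rw [Metric.tendsto_atTop]
  intro η hη
  -- The summand 1 covers a set `L` of measure zero and makes the final inequality strict.
  set ε : ℝ := η / (μ.real L + 1) with hε
  have hεpos : 0 < ε := by positivity
  obtain ⟨d, hd, hd'⟩ := Metric.uniformContinuous_iff.1
    (hgc.uniformContinuous_of_continuous hg) ε hεpos
  obtain ⟨N, hN⟩ := Metric.tendsto_atTop.1 hρ (min d 1) (by positivity)
  refine ⟨N, fun k hk => ?_⟩
  have hk' : (ρ k).rOut < min d 1 := by
    have := hN k hk
    rwa [Real.dist_eq, sub_zero, abs_of_pos (ρ k).rOut_pos] at this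
  have hpt : ∀ x, |((ρ k).normed μ ⋆[ContinuousLinearMap.lsmul ℝ ℝ, μ] g) x - g x|
      ≤ L.indicator (fun _ => ε) x := by
    intro x
    rw [← Real.dist_eq]
    refine ContDiffBump.dist_normed_convolution_le hg.aestronglyMeasurable fun y hy => ?_
    have hy' : dist y x < min d 1 := (Metric.mem_ball.1 hy).trans hk'
    by_cases hx : x ∈ L
    · rw [indicator_of_mem hx]
      exact (hd' (hy'.trans_le (min_le_left _ _))).le
    · have h1 : g x = 0 := image_eq_zero_of_notMem_tsupport fun h =>
        hx (Metric.self_subset_cthickening _ h)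
      have h2 : g y = 0 := image_eq_zero_of_notMem_tsupport fun h =>
        hx (Metric.mem_cthickening_of_dist_le x y 1 _ h (by
          rw [dist_comm]; exact (hy'.trans_le (min_le_right _ _)).le))
      rw [indicator_of_notMem hx, h1, h2, dist_self]
  have hle : ∫ x, |((ρ k).normed μ ⋆[ContinuousLinearMap.lsmul ℝ ℝ, μ] g) x - g x| ∂μ
      ≤ μ.real L * ε := by
    have e : ∫ x, L.indicator (fun _ => ε) x ∂μ = μ.real L * ε := by
      rw [integral_indicator hLc.measurableSet, setIntegral_const, smul_eq_mul]
    rw [← e]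
    refine integral_mono_of_nonneg (Eventually.of_forall fun x => abs_nonneg _) ?_
      (Eventually.of_forall hpt)
    exact (integrable_indicator_iff hLc.measurableSet).2
      (integrableOn_const hLc.measure_lt_top.ne)
  rw [Real.dist_eq, sub_zero, abs_of_nonneg (integral_nonneg fun x => abs_nonneg _)]
  refine hle.trans_lt ?_
  rw [hε, mul_div_assoc', div_lt_iff₀ (by positivity)]
  nlinarith

/-- Mollifications of an integrable function converge to it in `L¹`. -/
theorem ContDiffBump.tendsto_integral_abs_convolution_sub
    {ρ : ℕ → ContDiffBump (0 : E)} (hρ : Tendsto (fun k => (ρ k).rOut) atTop (𝓝 0)) {f : E → ℝ}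
    (hf : Integrable f μ) :
    Tendsto (fun k => ∫ x,
      |((ρ k).normed μ ⋆[ContinuousLinearMap.lsmul ℝ ℝ, μ] f) x - f x| ∂μ) atTop (𝓝 0) := by
  rw [Metric.tendsto_atTop]
  intro η hη
  -- Split ρ ⋆ f - f = ρ ⋆ (f - g) + (ρ ⋆ g - g) - (f - g); each term will cost at most η/4.
  obtain ⟨g, hgc, hfg, hg, hgi⟩ := hf.exists_hasCompactSupport_integral_sub_le
    (ε := η / 4) (by positivity)
  obtain ⟨N, hN⟩ := Metric.tendsto_atTop.1
    (tendsto_integral_abs_convolution_sub_of_continuous (μ := μ) hρ hg hgc) (η / 4) (by positivity)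
  refine ⟨N, fun k hk => ?_⟩
  have h1 := hN k hk
  rw [Real.dist_eq, sub_zero, abs_of_nonneg (integral_nonneg fun x => abs_nonneg _)] at h1 ⊢
  have hd : Integrable (fun x => f x - g x) μ := hf.sub hgi
  have h2 := (ρ k).integral_abs_normed_convolution_le hd
  simp only [Real.norm_eq_abs] at hfg
  have i1 : Integrable (fun x => |((ρ k).normed μ ⋆[ContinuousLinearMap.lsmul ℝ ℝ, μ]
      fun x => f x - g x) x|) μ := ((ρ k).integrable_normed.integrable_convolution _ hd).abs
  have i2 : Integrable (fun x => |((ρ k).normed μ ⋆[ContinuousLinearMap.lsmul ℝ ℝ, μ] g) x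
      - g x|) μ := (((ρ k).integrable_normed.integrable_convolution _ hgi).sub hgi).abs
  have hsplit : (ρ k).normed μ ⋆[ContinuousLinearMap.lsmul ℝ ℝ, μ] f
      = ((ρ k).normed μ ⋆[ContinuousLinearMap.lsmul ℝ ℝ, μ] g)
        + ((ρ k).normed μ ⋆[ContinuousLinearMap.lsmul ℝ ℝ, μ] fun x => f x - g x) := by
    rw [← ConvolutionExists.distrib_add]
    · congr 1
      funext x
      simp
    · exact (ρ k).hasCompactSupport_normed.convolutionExists_left _ (ρ k).continuous_normed
        hgi.locallyIntegrable
    · exact (ρ k).hasCompactSupport_normed.convolutionExists_left _ (ρ k).continuous_normed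
        hd.locallyIntegrable
  have h3 : ∫ x, |((ρ k).normed μ ⋆[ContinuousLinearMap.lsmul ℝ ℝ, μ] f) x - f x| ∂μ
      ≤ ∫ x, (|((ρ k).normed μ ⋆[ContinuousLinearMap.lsmul ℝ ℝ, μ] fun x => f x - g x) x|
        + |((ρ k).normed μ ⋆[ContinuousLinearMap.lsmul ℝ ℝ, μ] g) x - g x| + |f x - g x|) ∂μ := by
    refine integral_mono_of_nonneg (Eventually.of_forall fun x => abs_nonneg _)
      ((i1.add i2).add hd.abs) (Eventually.of_forall fun x => ?_)
    rw [hsplit]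
    simp only [Pi.add_apply]
    set p := ((ρ k).normed μ ⋆[ContinuousLinearMap.lsmul ℝ ℝ, μ] fun x => f x - g x) x
    set q := ((ρ k).normed μ ⋆[ContinuousLinearMap.lsmul ℝ ℝ, μ] g) x
    have e : q + p - f x = p + (q - g x) + -(f x - g x) := by ring
    rw [e]
    refine (abs_add_le _ _).trans ?_
    rw [abs_neg]
    gcongr
    exact abs_add_le _ _
  rw [integral_add (by exact i1.add i2) hd.abs, integral_add i1 i2] at h3
  linarith

end Mollifier

/-- The bound on `A k` handles A_k(b_k - c), and dominated convergence handles A_k c. Thus almost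
everywhere convergence suffices for the bounded factor. -/
theorem tendsto_integral_mul_of_bounded {α : Type*} [MeasurableSpace α] {μ : Measure α}
    {A b : ℕ → α → ℝ} {a c : α → ℝ} {C : ℝ} (hA : ∀ k, AEStronglyMeasurable (A k) μ)
    (hAC : ∀ k x, |A k x| ≤ C) (hAa : ∀ᵐ x ∂μ, Tendsto (fun k => A k x) atTop (𝓝 (a x)))
    (hb : ∀ k, Integrable (b k) μ) (hc : Integrable c μ)
    (hbc : Tendsto (fun k => ∫ x, |b k x - c x| ∂μ) atTop (𝓝 0)) :
    Tendsto (fun k => ∫ x, A k x * b k x ∂μ) atTop (𝓝 (∫ x, a x * c x ∂μ)) := by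
  have h1 : Tendsto (fun k => ∫ x, A k x * (b k x - c x) ∂μ) atTop (𝓝 0) := by
    refine squeeze_zero_norm (fun k => ?_) (by simpa using hbc.const_mul C)
    rw [← integral_const_mul]
    refine norm_integral_le_of_norm_le (((hb k).sub hc).abs.const_mul C)
      (Eventually.of_forall fun x => ?_)
    rw [norm_mul]
    exact mul_le_mul_of_nonneg_right (hAC k x) (norm_nonneg _)
  have h2 : Tendsto (fun k => ∫ x, A k x * c x ∂μ) atTop (𝓝 (∫ x, a x * c x ∂μ)) := by
    refine tendsto_integral_of_dominated_convergence (fun x => C * |c x|)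
      (fun k => (hA k).mul hc.1) (hc.abs.const_mul C) (fun k => Eventually.of_forall fun x => ?_) ?_
    · rw [norm_mul]
      exact mul_le_mul_of_nonneg_right (hAC k x) (norm_nonneg _)
    · filter_upwards [hAa] with x hx using hx.mul_const _
  have h3 := h1.add h2
  rw [zero_add] at h3
  refine h3.congr fun k => ?_
  rw [← integral_add]
  · refine integral_congr_ae (Eventually.of_forall fun x => ?_)
    simp only
    ring
  · exact ((hb k).sub hc).bdd_mul (c := C) (hA k) (Eventually.of_forall (hAC k))
  · exact hc.bdd_mul (c := C) (hA k) (Eventually.of_forall (hAC k))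

/-! ### The chain rule for weak gradients -/

section ChainRule

variable {n : ℕ} {Ω : Set (Eucl n)}

theorem integral_mul_indicator_eq {L : Set (Eucl n)} (hLΩ : L ⊆ Ω)
    (hΩ : MeasurableSet Ω) {F v : Eucl n → ℝ} (hF : ∀ x, x ∉ L → F x = 0) :
    ∫ x, F x * L.indicator v x = ∫ x in Ω, v x * F x := by
  rw [← setIntegral_eq_integral_of_forall_compl_eq_zero (s := Ω)
    fun x hx => by rw [hF x fun h => hx (hLΩ h), zero_mul]]
  refine setIntegral_congr_fun hΩ fun x _ => ?_
  by_cases hx : x ∈ L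
  · simp [hx, mul_comm]
  · simp [hF x hx]

/-- Mollification commutes with the weak gradient away from the boundary. -/
theorem HasWeakGradient.fderiv_convolution_eq (hΩ : IsOpen Ω) {v : Eucl n → ℝ}
    {g : Eucl n → Eucl n} (h : HasWeakGradient Ω v g) {L : Set (Eucl n)}
    (hLΩ : L ⊆ Ω) (hv : Integrable (L.indicator v)) (i : Fin n) (ρ : ContDiffBump (0 : Eucl n))
    {x : Eucl n} (hx : Metric.closedBall x ρ.rOut ⊆ L) :
    fderiv ℝ (ρ.normed volume ⋆[ContinuousLinearMap.lsmul ℝ ℝ, volume] L.indicator v) x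
        (EuclideanSpace.single i 1)
      = (ρ.normed volume ⋆[ContinuousLinearMap.lsmul ℝ ℝ, volume]
          L.indicator fun y => g y i) x := by
  set η : Eucl n → ℝ := ρ.normed volume with hη
  have η1 : ContDiff ℝ ∞ η := ρ.contDiff_normed
  have η2 : HasCompactSupport η := ρ.hasCompactSupport_normed
  have ηs : ∀ y, x - y ∈ tsupport η → y ∈ Metric.closedBall x ρ.rOut := by
    intro y hy
    rw [hη, ρ.tsupport_normed_eq] at hy
    rw [mem_closedBall_iff_norm] at hy ⊢
    rwa [sub_zero, norm_sub_rev] at hy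
  have hd := (η2.hasFDerivAt_convolution_left (ContinuousLinearMap.lsmul ℝ ℝ)
    (η1.of_le (by simp)) hv.locallyIntegrable x).fderiv
  have hex := (η2.fderiv ℝ).convolutionExists_left
    ((ContinuousLinearMap.lsmul ℝ ℝ : ℝ →L[ℝ] ℝ →L[ℝ] ℝ).precompL (Eucl n))
    (η1.continuous_fderiv (by simp)) hv.locallyIntegrable x
  have hint : Integrable fun t => (((ContinuousLinearMap.lsmul ℝ ℝ : ℝ →L[ℝ] ℝ →L[ℝ] ℝ).precompL
      (Eucl n)) (fderiv ℝ η (x - t))) (L.indicator v t) := hex.integrable_swap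
  rw [hd, convolution_eq_swap, ContinuousLinearMap.integral_apply hint, convolution_eq_swap]
  simp only [ContinuousLinearMap.precompL_apply, ContinuousLinearMap.lsmul_apply, smul_eq_mul]
  rw [integral_mul_indicator_eq (F := fun t => fderiv ℝ η (x - t) (EuclideanSpace.single i 1))
      hLΩ hΩ.measurableSet, integral_mul_indicator_eq (F := fun t => η (x - t)) hLΩ
      hΩ.measurableSet]
  · have θs : tsupport (fun t => η (x - t)) ⊆ Metric.closedBall x ρ.rOut :=
      closure_minimal (fun y hy => ηs y (subset_tsupport _ hy)) Metric.isClosed_closedBall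
    -- The test function is the reflected mollifier y ↦ η(x - y). The sign from the reflection
    -- cancels the one in the weak gradient.
    have e := h (fun t => η (x - t)) (η1.comp (contDiff_const.sub contDiff_id))
      ((isCompact_closedBall x ρ.rOut).of_isClosed_subset (isClosed_tsupport _) θs)
      (θs.trans (hx.trans hLΩ)) i
    have hder : ∀ t, fderiv ℝ (fun t => η (x - t)) t = -fderiv ℝ η (x - t) := fun t => by
      have h1 : HasFDerivAt (fun t => x - t) (-ContinuousLinearMap.id ℝ (Eucl n)) t :=
        (hasFDerivAt_id t).const_sub x
      have h2 := ((η1.differentiable (by simp)) (x - t)).hasFDerivAt.comp t h1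
      exact h2.fderiv.trans (by ext; simp)
    simp only [hder, neg_apply, mul_neg, integral_neg, neg_inj] at e
    exact e
  · intro y hy
    exact image_eq_zero_of_notMem_tsupport fun h' => hy (hx (ηs y h'))
  · intro y hy
    rw [image_eq_zero_of_notMem_tsupport (f := fderiv ℝ η) fun h' =>
      hy (hx (ηs y (tsupport_fderiv_subset ℝ h')))]
    simp

/-- The chain rule for weak gradients. -/
theorem HasWeakGradient.comp (hΩ : IsOpen Ω) {v : Eucl n → ℝ} {g : Eucl n → Eucl n}
    (h : HasWeakGradient Ω v g) (hv : MemLp v 2 (volume.restrict Ω))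
    (hg : ∀ i, MemLp (fun x => g x i) 2 (volume.restrict Ω)) {G : ℝ → ℝ} (hG : ContDiff ℝ 1 G)
    (hG0 : G 0 = 0) (hG' : ∀ s, |deriv G s| ≤ 1) :
    HasWeakGradient Ω (fun x => G (v x)) (fun x => deriv G (v x) • g x) := by
  intro φ φ1 φ2 φ3 i
  -- Cutting off to a compact neighbourhood of supp φ inside Ω allows mollification on the whole
  -- space; mollifying and differentiating need to commute only on supp φ.
  obtain ⟨δ, hδ, hLΩ⟩ := φ2.isCompact.exists_cthickening_subset_open hΩ φ3
  set L := Metric.cthickening δ (tsupport φ) with hLdef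
  have hLc : IsCompact L := φ2.isCompact.cthickening
  have hLm : MeasurableSet L := hLc.measurableSet
  have hK : tsupport φ ⊆ L := Metric.self_subset_cthickening _
  have hfin : IsFiniteMeasure (volume.restrict L) := ⟨by simpa using hLc.measure_lt_top⟩
  have hLi : ∀ f : Eucl n → ℝ, MemLp f 2 (volume.restrict Ω) → Integrable (L.indicator f) :=
    fun f hf => (integrable_indicator_iff hLm).2
      ((hf.mono_measure (Measure.restrict_mono hLΩ le_rfl)).integrable one_le_two)
  have hvi := hLi v hv
  have hgi := hLi _ (hg i)
  set e : Eucl n := EuclideanSpace.single i 1 with he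
  have hLip : ∀ a b, |G a - G b| ≤ |a - b| := by
    intro a b
    have := convex_univ.norm_image_sub_le_of_norm_deriv_le (f := G) (C := 1) (x := b) (y := a)
      (fun x _ => (hG.differentiable (by simp)) x) (fun x _ => hG' x) (mem_univ _) (mem_univ _)
    simpa using this
  have hG'c : Continuous (deriv G) := hG.continuous_deriv le_rfl
  -- Radii at most δ keep the mollification inside `L`; the fixed ratio 2 of the radii gives almost
  -- everywhere convergence.
  let ρ : ℕ → ContDiffBump (0 : Eucl n) := fun k =>
    ⟨δ / (k + 1) / 2, δ / (k + 1), by positivity, half_lt_self (by positivity)⟩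
  have hρ : Tendsto (fun k => (ρ k).rOut) atTop (𝓝 0) :=
    by simpa [ρ, div_eq_mul_inv] using tendsto_one_div_add_atTop_nhds_zero_nat.const_mul δ
  have hρδ : ∀ k, (ρ k).rOut ≤ δ := fun k => div_le_self hδ.le (by simp)
  set w : ℕ → Eucl n → ℝ := fun k =>
    (ρ k).normed volume ⋆[ContinuousLinearMap.lsmul ℝ ℝ, volume] L.indicator v with hw
  set z : ℕ → Eucl n → ℝ := fun k =>
    (ρ k).normed volume ⋆[ContinuousLinearMap.lsmul ℝ ℝ, volume]
      L.indicator fun y => g y i with hz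
  have hw1 : ∀ k, ContDiff ℝ 1 (w k) := fun k =>
    (ρ k).hasCompactSupport_normed.contDiff_convolution_left _ (n := 1) (ρ k).contDiff_normed
      hvi.locallyIntegrable
  have hwi : ∀ k, Integrable (w k) := fun k => (ρ k).integrable_normed.integrable_convolution _ hvi
  have hzi : ∀ k, Integrable (z k) := fun k => (ρ k).integrable_normed.integrable_convolution _ hgi
  have hwz : ∀ k, ∀ x ∈ tsupport φ, fderiv ℝ (w k) x e = z k x := fun k x hx =>
    h.fderiv_convolution_eq hΩ hLΩ hvi i (ρ k)
      ((Metric.closedBall_subset_cthickening hx _).trans (Metric.cthickening_mono (hρδ k) _))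
  have hwae : ∀ᵐ x, Tendsto (fun k => w k x) atTop (𝓝 (L.indicator v x)) :=
    ContDiffBump.ae_convolution_tendsto_right_of_locallyIntegrable (K := 2) hρ
      (Eventually.of_forall fun k => by
        change δ / (k + 1) ≤ 2 * (δ / (k + 1) / 2)
        linarith) hvi.locallyIntegrable
  have hdφ : Continuous fun x => fderiv ℝ φ x e := continuous_partial φ1 e
  have hdφc : HasCompactSupport fun x => fderiv ℝ φ x e := compactSupport_partial φ2 e
  have hibp : ∀ k, ∫ x, fderiv ℝ φ x e * G (w k x) = -∫ x, (deriv G (w k x) * φ x) * z k x := by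
    intro k
    have hGw : ContDiff ℝ 1 fun x => G (w k x) := hG.comp (hw1 k)
    have hfd : ∀ x, fderiv ℝ (fun x => G (w k x)) x e = deriv G (w k x) * fderiv ℝ (w k) x e := by
      intro x
      have := ((hG.differentiable (by simp)) (w k x)).hasDerivAt.comp_hasFDerivAt x
        (((hw1 k).differentiable (by simp)) x).hasFDerivAt
      have h2 : fderiv ℝ (fun x => G (w k x)) x = deriv G (w k x) • fderiv ℝ (w k) x := this.fderiv
      rw [h2]
      simp
    have hGwd : Continuous fun x => fderiv ℝ (fun x => G (w k x)) x e :=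
      (hGw.continuous_fderiv (by simp)).clm_apply continuous_const
    have := integral_mul_fderiv_eq_neg_fderiv_mul_of_integrable (μ := (volume : Measure (Eucl n)))
      (f := fun x => G (w k x)) (g := φ) (v := e)
      ((hGwd.mul φ1.continuous).integrable_of_hasCompactSupport φ2.mul_left)
      ((hGw.continuous.mul hdφ).integrable_of_hasCompactSupport hdφc.mul_left)
      ((hGw.continuous.mul φ1.continuous).integrable_of_hasCompactSupport φ2.mul_left)
      (fun x _ => (hGw.differentiable (by simp)) x) (fun x _ => (φ1.differentiable (by simp)) x)
    simp only [mul_comm (fderiv ℝ φ _ e)]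
    rw [this]
    congr 1
    refine integral_congr_ae (Eventually.of_forall fun x => ?_)
    simp only [hfd]
    by_cases hx : x ∈ tsupport φ
    · rw [hwz k x hx]; ring
    · rw [image_eq_zero_of_notMem_tsupport hx]; ring
  obtain ⟨C, hC⟩ := φ1.continuous.bounded_above_of_compact_support φ2
  obtain ⟨C', hC'⟩ := hdφ.bounded_above_of_compact_support hdφc
  have hGi : ∀ f : Eucl n → ℝ, Integrable f → Integrable fun x => G (f x) := fun f hf =>
    hf.mono (hG.continuous.comp_aestronglyMeasurable hf.1) (Eventually.of_forall fun x => by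
      simpa [hG0] using hLip (f x) 0)
  have l1 : Tendsto (fun k => ∫ x, fderiv ℝ φ x e * G (w k x)) atTop
      (𝓝 (∫ x, fderiv ℝ φ x e * G (L.indicator v x))) := by
    refine tendsto_integral_mul_of_bounded (C := C') (fun k => hdφ.aestronglyMeasurable)
      (fun k x => hC' x) (Eventually.of_forall fun x => tendsto_const_nhds)
      (fun k => hGi _ (hwi k)) (hGi _ hvi) ?_
    refine squeeze_zero (fun k => integral_nonneg fun x => abs_nonneg _) (fun k => ?_)
      (ContDiffBump.tendsto_integral_abs_convolution_sub hρ hvi)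
    exact integral_mono_of_nonneg (Eventually.of_forall fun x => abs_nonneg _)
      ((hwi k).sub hvi).abs (Eventually.of_forall fun x => hLip _ _)
  -- G'(w_k) is bounded and converges almost everywhere because G' is continuous, while z_k
  -- converges in L¹.
  have l2 : Tendsto (fun k => ∫ x, (deriv G (w k x) * φ x) * z k x) atTop
      (𝓝 (∫ x, (deriv G (L.indicator v x) * φ x) * L.indicator (fun y => g y i) x)) := by
    refine tendsto_integral_mul_of_bounded (C := C)
      (fun k => ((hG'c.comp (hw1 k).continuous).mul φ1.continuous).aestronglyMeasurable)
      (fun k x => ?_) ?_ hzi hgi (ContDiffBump.tendsto_integral_abs_convolution_sub hρ hgi)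
    · rw [abs_mul]
      have := hC x
      rw [Real.norm_eq_abs] at this
      nlinarith [hG' (w k x), abs_nonneg (φ x), abs_nonneg (deriv G (w k x))]
    · filter_upwards [hwae] with x hx
      exact ((hG'c.tendsto _).comp hx).mul_const _
  have hlim := tendsto_nhds_unique l1 (l2.neg.congr fun k => (hibp k).symm)
  have c1 : ∫ x in Ω, G (v x) * fderiv ℝ φ x e = ∫ x, fderiv ℝ φ x e * G (L.indicator v x) := by
    have hz : ∀ x, x ∉ tsupport φ → fderiv ℝ φ x e = 0 := fun x hx => by
      rw [image_eq_zero_of_notMem_tsupport (f := fderiv ℝ φ)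
        fun h' => hx (tsupport_fderiv_subset ℝ h')]
      simp
    rw [← setIntegral_eq_integral_of_forall_compl_eq_zero (s := Ω)
      (f := fun x => fderiv ℝ φ x e * G (L.indicator v x))
      fun x hx => by rw [hz x fun h' => hx (φ3 h'), zero_mul]]
    refine setIntegral_congr_fun hΩ.measurableSet fun x _ => ?_
    by_cases hx : x ∈ tsupport φ
    · simp [hK hx, mul_comm]
    · simp [hz x hx]
  have c2 : ∫ x in Ω, (deriv G (v x) • g x) i * φ x
      = ∫ x, (deriv G (L.indicator v x) * φ x) * L.indicator (fun y => g y i) x := by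
    have hz : ∀ x, x ∉ tsupport φ → φ x = 0 := fun x hx => image_eq_zero_of_notMem_tsupport hx
    rw [← setIntegral_eq_integral_of_forall_compl_eq_zero (s := Ω)
      (f := fun x => (deriv G (L.indicator v x) * φ x) * L.indicator (fun y => g y i) x)
      fun x hx => by rw [hz x fun h' => hx (φ3 h'), mul_zero, zero_mul]]
    refine setIntegral_congr_fun hΩ.measurableSet fun x _ => ?_
    by_cases hx : x ∈ tsupport φ
    · simp [hK hx, mul_comm, mul_assoc]
    · simp [hz x hx]
  rw [c1, c2, hlim]

theorem hasDerivAt_sqrt_sq_add {d : ℝ} (hd : 0 < d) (s : ℝ) :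
    HasDerivAt (fun s => √(s ^ 2 + d ^ 2) - d) (s / √(s ^ 2 + d ^ 2)) s := by
  have h := (((hasDerivAt_pow 2 s).add_const (d ^ 2)).sqrt (by positivity)).sub_const d
  exact h.congr_deriv (by simp; field_simp)

theorem contDiff_sqrt_sq_add {d : ℝ} (hd : 0 < d) :
    ContDiff ℝ 1 (fun s : ℝ => √(s ^ 2 + d ^ 2) - d) :=
  (((contDiff_id.pow 2).add contDiff_const).sqrt fun s => by
    have : 0 < id s ^ 2 + d ^ 2 := by positivity
    exact this.ne').sub contDiff_const

/-- The weak gradient of `|v|` is `sign(v) ∇v`. -/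
theorem HasWeakGradient.abs (hΩ : IsOpen Ω) {v : Eucl n → ℝ} {g : Eucl n → Eucl n}
    (h : HasWeakGradient Ω v g) (hv : MemLp v 2 (volume.restrict Ω))
    (hg : ∀ i, MemLp (fun x => g x i) 2 (volume.restrict Ω)) :
    HasWeakGradient Ω (fun x => |v x|) (fun x => (v x / |v x|) • g x) := by
  intro φ φ1 φ2 φ3 i
  -- The functions √(s² + d²) - d are C¹, vanish at 0, have slope at most 1 and tend to |s| as d →
  -- 0.
  set d : ℕ → ℝ := fun k => 1 / ((k : ℝ) + 1) with hd
  have hdpos : ∀ k, 0 < d k := fun k => by positivity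
  have hd0 : Tendsto d atTop (𝓝 0) := tendsto_one_div_add_atTop_nhds_zero_nat
  have hsq : ∀ k s, |s| ≤ √(s ^ 2 + d k ^ 2) := fun k s => by
    rw [← Real.sqrt_sq_eq_abs]
    exact Real.sqrt_le_sqrt (by nlinarith [sq_nonneg (d k)])
  have hsq' : ∀ k s, √(s ^ 2 + d k ^ 2) ≤ |s| + d k := fun k s => by
    refine Real.sqrt_le_iff.2 ⟨by have := hdpos k; positivity, ?_⟩
    nlinarith [sq_abs s, mul_nonneg (abs_nonneg s) (hdpos k).le]
  have hspos : ∀ k s, 0 < √(s ^ 2 + d k ^ 2) := fun k s => by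
    have := hdpos k
    positivity
  have hder : ∀ k s, deriv (fun s => √(s ^ 2 + d k ^ 2) - d k) s = s / √(s ^ 2 + d k ^ 2) :=
    fun k s => (hasDerivAt_sqrt_sq_add (hdpos k) s).deriv
  have hle : ∀ k s, |s / √(s ^ 2 + d k ^ 2)| ≤ 1 := fun k s => by
    rw [abs_div, abs_of_pos (hspos k s), div_le_one (hspos k s)]
    exact hsq k s
  have hk : ∀ k, HasWeakGradient Ω (fun x => √(v x ^ 2 + d k ^ 2) - d k)
      (fun x => (v x / √(v x ^ 2 + d k ^ 2)) • g x) := by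
    intro k
    have := h.comp hΩ hv hg (contDiff_sqrt_sq_add (hdpos k))
      (by simp [Real.sqrt_sq (hdpos k).le]) (fun s => by rw [hder]; exact hle k s)
    simpa only [hder] using this
  have hdφ := continuous_partial φ1 (EuclideanSpace.single i 1)
  have hdφc := compactSupport_partial φ2 (EuclideanSpace.single i 1)
  have l1 : Tendsto (fun k => ∫ x in Ω, (√(v x ^ 2 + d k ^ 2) - d k)
      * fderiv ℝ φ x (EuclideanSpace.single i 1)) atTop
      (𝓝 (∫ x in Ω, |v x| * fderiv ℝ φ x (EuclideanSpace.single i 1))) := by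
    refine tendsto_integral_of_dominated_convergence
      (fun x => ‖v x * fderiv ℝ φ x (EuclideanSpace.single i 1)‖) (fun k => ?_)
      (integrable_L2_mul_test v hv _ hdφ hdφc).norm
      (fun k => Eventually.of_forall fun x => ?_) (Eventually.of_forall fun x => ?_)
    · exact ((contDiff_sqrt_sq_add (hdpos k)).continuous.comp_aestronglyMeasurable hv.1).mul
        hdφ.aestronglyMeasurable
    · rw [norm_mul, norm_mul]
      refine mul_le_mul_of_nonneg_right ?_ (norm_nonneg _)
      rw [Real.norm_eq_abs, Real.norm_eq_abs, abs_le]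
      constructor <;>
        linarith [hsq k (v x), hsq' k (v x), abs_nonneg (v x), hspos k (v x), hdpos k,
          Real.sqrt_le_sqrt (show d k ^ 2 ≤ v x ^ 2 + d k ^ 2 by nlinarith [sq_nonneg (v x)]),
          Real.sqrt_sq (hdpos k).le]
    · refine Tendsto.mul_const _ ?_
      have hc : Continuous fun r : ℝ => √(v x ^ 2 + r ^ 2) - r := by fun_prop
      have := (hc.tendsto 0).comp hd0
      simpa [Function.comp_def, Real.sqrt_sq_eq_abs] using this
  have l2 : Tendsto (fun k => ∫ x in Ω, ((v x / √(v x ^ 2 + d k ^ 2)) • g x) i * φ x) atTop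
      (𝓝 (∫ x in Ω, ((v x / |v x|) • g x) i * φ x)) := by
    refine tendsto_integral_of_dominated_convergence (fun x => ‖g x i * φ x‖) (fun k => ?_)
      (integrable_L2_mul_test _ (hg i) _ φ1.continuous φ2).norm
      (fun k => Eventually.of_forall fun x => ?_) (Eventually.of_forall fun x => ?_)
    · simp only [PiLp.smul_apply, smul_eq_mul]
      have hc : Continuous fun s : ℝ => s / √(s ^ 2 + d k ^ 2) :=
        continuous_id.div (by fun_prop) fun s => (hspos k s).ne'
      exact ((hc.comp_aestronglyMeasurable hv.1).mul (hg i).1).mul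
        φ1.continuous.aestronglyMeasurable
    · rw [PiLp.smul_apply, smul_eq_mul, mul_assoc, norm_mul]
      exact mul_le_of_le_one_left (norm_nonneg _) (hle k _)
    · simp only [PiLp.smul_apply, smul_eq_mul]
      refine (Tendsto.mul_const _ ?_).mul_const _
      -- Where v = 0 the approximating slopes vanish, matching the convention 0 / 0 = 0; so it is
      -- not needed that ∇v = 0 almost everywhere there.
      by_cases hx : v x = 0
      · simp [hx]
      · have hc : ContinuousAt (fun r : ℝ => v x / √(v x ^ 2 + r ^ 2)) 0 := by
          refine continuousAt_const.div (by fun_prop) ?_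
          have : 0 < v x ^ 2 := by positivity
          simpa [Real.sqrt_sq_eq_abs] using hx
        have := hc.tendsto.comp hd0
        simpa [Function.comp_def, Real.sqrt_sq_eq_abs] using this
  exact tendsto_nhds_unique l1 (l2.neg.congr fun k => (hk k φ φ1 φ2 φ3 i).symm)

end ChainRule

/-! ### H¹(Ω): completeness, separability and positive parts -/

/-- Each test function and index imposes an equality of two L²-continuous functionals. Closedness
gives the completeness on which Riesz representation and the V-valued integrals rest. -/
theorem isClosed_sobolevSubmodule {n : ℕ} (Ω : Set (Eucl n)) :
    IsClosed (sobolevSubmodule Ω : Set (WithLp 2 (L2Space Ω × L2Field Ω))) := by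
  have key : (sobolevSubmodule Ω : Set (WithLp 2 (L2Space Ω × L2Field Ω)))
      = ⋂ (φ : Eucl n → ℝ) (_ : ContDiff ℝ ∞ φ) (_ : HasCompactSupport φ) (_ : tsupport φ ⊆ Ω)
          (i : Fin n), {p | ∫ x in Ω, p.fst x * fderiv ℝ φ x (EuclideanSpace.single i 1)
            = -∫ x in Ω, p.snd x i * φ x} := by
    ext p
    simp only [mem_iInter, mem_ofPred_eq]
    rfl
  rw [key]
  refine isClosed_iInter fun φ => isClosed_iInter fun h1 => isClosed_iInter fun h2 =>
    isClosed_iInter fun _ => isClosed_iInter fun i => ?_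
  have hpair : ∀ ψ : Eucl n → ℝ, Continuous ψ → HasCompactSupport ψ →
      Continuous fun f : L2Space Ω => ∫ x in Ω, f x * ψ x := by
    intro ψ hψ hc
    have hm : MemLp ψ 2 (volume.restrict Ω) := hψ.memLp_of_hasCompactSupport hc
    have : Continuous fun f : L2Space Ω => ⟪hm.toLp ψ, f⟫ := continuous_const.inner continuous_id
    refine this.congr fun f => ?_
    rw [L2.inner_def]
    refine integral_congr_ae ?_
    filter_upwards [hm.coeFn_toLp] with x hx
    rw [hx]
    simp
  have hsnd : Continuous fun p : WithLp 2 (L2Space Ω × L2Field Ω) => ∫ x in Ω, p.snd x i * φ x := by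
    have hc : Continuous fun p : WithLp 2 (L2Space Ω × L2Field Ω) =>
        (EuclideanSpace.proj i : Eucl n →L[ℝ] ℝ).compLpL 2 (volume.restrict Ω) p.snd :=
      (ContinuousLinearMap.continuous _).comp (WithLp.sndL 2 ℝ (L2Space Ω) (L2Field Ω)).continuous
    refine ((hpair φ h1.continuous h2).comp hc).congr fun p => integral_congr_ae ?_
    filter_upwards [(EuclideanSpace.proj i : Eucl n →L[ℝ] ℝ).coeFn_compLpL (p := 2) p.snd] with x hx
    rw [hx]
    rfl
  have hfst : Continuous fun p : WithLp 2 (L2Space Ω × L2Field Ω) =>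
      ∫ x in Ω, p.fst x * fderiv ℝ φ x (EuclideanSpace.single i 1) :=
    (hpair _ (continuous_partial h1 _) (compactSupport_partial h2 _)).comp
      (WithLp.fstL 2 ℝ (L2Space Ω) (L2Field Ω)).continuous
  exact isClosed_eq hfst hsnd.neg

instance SobolevH1.instCompleteSpace {n : ℕ} (Ω : Set (Eucl n)) : CompleteSpace (SobolevH1 Ω) :=
  (isClosed_sobolevSubmodule Ω).completeSpace_coe

instance SobolevH1.instSecondCountableTopology {n : ℕ} (Ω : Set (Eucl n)) :
    SecondCountableTopology (SobolevH1 Ω) := by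
  have : Fact ((2 : ENNReal) ≠ ⊤) := ⟨by simp⟩
  have : IsSeparable ((volume : Measure (Eucl n)).restrict Ω) := inferInstance
  have : SecondCountableTopology (L2Space Ω) := inferInstance
  have : SecondCountableTopology (L2Field Ω) := inferInstance
  have : SecondCountableTopology (WithLp 2 (L2Space Ω × L2Field Ω)) :=
    (WithLp.homeomorphProd 2 (L2Space Ω) (L2Field Ω)).secondCountableTopology
  exact inferInstanceAs (SecondCountableTopology (sobolevSubmodule Ω))

theorem SobolevH1.norm_sq {n : ℕ} {Ω : Set (Eucl n)} (v : SobolevH1 Ω) :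
    ‖v‖ ^ 2 = ‖v.1.fst‖ ^ 2 + ‖v.1.snd‖ ^ 2 :=
  WithLp.prod_norm_sq_eq_of_L2 v.1

theorem HasWeakGradient.congr_ae {n : ℕ} {Ω : Set (Eucl n)} {f f' : Eucl n → ℝ}
    {g g' : Eucl n → Eucl n} (h : HasWeakGradient Ω f g) (hf : f =ᵐ[volume.restrict Ω] f')
    (hg : g =ᵐ[volume.restrict Ω] g') : HasWeakGradient Ω f' g' := by
  intro φ h1 h2 h3 i
  rw [← integral_congr_ae (hf.mono fun x hx => by simp only [hx] :
      (fun x => f x * fderiv ℝ φ x (EuclideanSpace.single i 1)) =ᵐ[volume.restrict Ω] _),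
    h φ h1 h2 h3 i]
  congr 1
  exact integral_congr_ae (hg.mono fun x hx => by simp only [hx])

/-- A weak gradient is determined almost everywhere by its function, by the fundamental lemma of the
calculus of variations. -/
theorem SobolevH1.toL2_injective {n : ℕ} {Ω : Set (Eucl n)} (hΩ : IsOpen Ω) :
    Function.Injective (SobolevH1.toL2 Ω) := by
  refine (injective_iff_map_eq_zero _).2 fun v hv => ?_
  have hfst : v.1.fst = 0 := hv
  have hw : HasWeakGradient Ω v.1.fst v.1.snd := v.2
  have hsnd : v.1.snd = 0 := by
    have hcoord : ∀ i : Fin n, ∀ᵐ x ∂(volume.restrict Ω), v.1.snd x i = 0 := by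
      intro i
      rw [ae_restrict_iff' hΩ.measurableSet]
      refine hΩ.ae_eq_zero_of_integral_contDiff_smul_eq_zero ?_ fun φ h1 h2 h3 => ?_
      · rw [locallyIntegrableOn_iff hΩ.isLocallyClosed]
        intro k hk hkc
        have : IsFiniteMeasure (volume.restrict k) := ⟨by simpa using hkc.measure_lt_top⟩
        exact ((memLp_coord v.1.snd i).mono_measure (Measure.restrict_mono hk le_rfl)).integrable
          one_le_two
      · have e := hw φ h1 h2 h3 i
        have z : ∫ x in Ω, v.1.fst x * fderiv ℝ φ x (EuclideanSpace.single i 1) = 0 := by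
          refine integral_eq_zero_of_ae ?_
          rw [hfst]
          filter_upwards [Lp.coeFn_zero ℝ 2 (volume.restrict Ω)] with x hx
          rw [hx]
          simp
        rw [z, eq_comm, neg_eq_zero] at e
        rw [← e, ← setIntegral_eq_integral_of_forall_compl_eq_zero (s := Ω) fun x hx => by
          rw [image_eq_zero_of_notMem_tsupport fun h' => hx (h3 h'), zero_smul]]
        simp [mul_comm]
    rw [Lp.eq_zero_iff_ae_eq_zero]
    filter_upwards [ae_all_iff.2 hcoord] with x hx
    ext i
    exact hx i
  refine Subtype.ext ?_
  refine (WithLp.ofLp_injective 2) (Prod.ext hfst hsnd)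

/-- The factor v/|v| has modulus at most one, so it does not increase the norm of the gradient. -/
theorem SobolevH1.exists_abs {n : ℕ} {Ω : Set (Eucl n)} (hΩ : IsOpen Ω) (v : SobolevH1 Ω) :
    ∃ w : SobolevH1 Ω, SobolevH1.toL2 Ω w = |SobolevH1.toL2 Ω v| ∧ ‖w‖ ≤ ‖v‖ := by
  have hv : HasWeakGradient Ω v.1.fst v.1.snd := v.2
  have habs := hv.abs hΩ (Lp.memLp v.1.fst) (memLp_coord v.1.snd)
  set s : Eucl n → ℝ := fun x => v.1.fst x / |v.1.fst x| with hs
  have hs1 : ∀ x, |s x| ≤ 1 := fun x => by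
    simp only [hs, abs_div, abs_abs]
    exact div_self_le_one _
  have hsm : AEStronglyMeasurable s (volume.restrict Ω) :=
    ((Lp.stronglyMeasurable v.1.fst).measurable.div
      (Lp.stronglyMeasurable v.1.fst).measurable.abs).aestronglyMeasurable
  have hle : ∀ x, ‖s x • v.1.snd x‖ ≤ ‖v.1.snd x‖ := fun x => by
    rw [norm_smul]
    exact mul_le_of_le_one_left (norm_nonneg _) (hs1 x)
  have hm : MemLp (fun x => s x • v.1.snd x) 2 (volume.restrict Ω) :=
    (Lp.memLp v.1.snd).of_le (hsm.smul (Lp.memLp v.1.snd).1) (Eventually.of_forall hle)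
  set p : WithLp 2 (L2Space Ω × L2Field Ω) := WithLp.toLp 2 (|v.1.fst|, hm.toLp _) with hp
  have hpm : p ∈ sobolevSubmodule Ω :=
    habs.congr_ae (Lp.coeFn_abs v.1.fst).symm hm.coeFn_toLp.symm
  obtain ⟨w, hw⟩ : ∃ w : SobolevH1 Ω, w.1 = p := ⟨⟨p, hpm⟩, rfl⟩
  have hfst : SobolevH1.toL2 Ω w = w.1.fst := rfl
  refine ⟨w, by rw [hfst, hw]; rfl, ?_⟩
  refine (sq_le_sq₀ (norm_nonneg _) (norm_nonneg v)).1 ?_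
  rw [SobolevH1.norm_sq, SobolevH1.norm_sq, hw]
  have n1 : ‖p.fst‖ = ‖v.1.fst‖ := norm_abs_eq_norm v.1.fst
  have n2 : ‖p.snd‖ ≤ ‖v.1.snd‖ := by
    refine Lp.norm_le_norm_of_ae_le ?_
    filter_upwards [hm.coeFn_toLp] with x hx
    change ‖hm.toLp _ x‖ ≤ _
    rw [hx]
    exact hle x
  rw [n1]
  gcongr

/-- The positive part of an `H¹` function is an `H¹` function. -/
theorem SobolevH1.exists_posPart {n : ℕ} {Ω : Set (Eucl n)} (hΩ : IsOpen Ω) (v : SobolevH1 Ω) :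
    ∃ w : SobolevH1 Ω, SobolevH1.toL2 Ω w = Lp.posPart (SobolevH1.toL2 Ω v) ∧ ‖w‖ ≤ ‖v‖ := by
  obtain ⟨a, ha, hle⟩ := SobolevH1.exists_abs hΩ v
  refine ⟨(2⁻¹ : ℝ) • (v + a), ?_, ?_⟩
  · rw [map_smul, map_add, ha]
    refine Lp.ext ?_
    set f := SobolevH1.toL2 Ω v
    filter_upwards [Lp.coeFn_smul (2⁻¹ : ℝ) (f + |f|), Lp.coeFn_add f |f|, Lp.coeFn_abs f,
      Lp.coeFn_posPart f] with x h1 h2 h3 h4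
    rw [h1, h4, Pi.smul_apply, h2, Pi.add_apply, h3, smul_eq_mul]
    rcases le_total 0 (f x) with h | h
    · rw [abs_of_nonneg h, max_eq_left h]; ring
    · rw [abs_of_nonpos h, max_eq_right h]; ring
  · rw [norm_smul]
    have := norm_add_le v a
    norm_num
    linarith

/-! ### The positive part along the evolution -/

/-- By Lusin–Souslin the injection V → H is a measurable embedding, so v ↦ v⁺ is measurable into V
because it is continuous into H. Continuity in the H¹ norm is not needed, and ‖v⁺‖ ≤ ‖v‖ gives
square integrability. -/
theorem exists_isPosPartInL2V {n : ℕ} {Ω : Set (Eucl n)} (hΩ : IsOpen Ω) {T : ℝ}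
    {u : ℝ → SobolevH1 Ω} (hu : MemLp u 2 (volume.restrict (Ioo 0 T))) :
    ∃ up, IsPosPartInL2V Ω T u up := by
  choose P hP hPle using SobolevH1.exists_posPart hΩ
  borelize (SobolevH1 Ω) (L2Space Ω)
  have hemb : MeasurableEmbedding (SobolevH1.toL2 Ω) :=
    (SobolevH1.toL2 Ω).continuous.measurableEmbedding (SobolevH1.toL2_injective hΩ)
  have hPm : Measurable P := by
    rw [← hemb.measurable_comp_iff]
    have e : SobolevH1.toL2 Ω ∘ P = fun v => Lp.posPart (SobolevH1.toL2 Ω v) := funext hP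
    rw [e]
    exact (Lp.continuous_posPart.comp (SobolevH1.toL2 Ω).continuous).measurable
  refine ⟨fun t => P (u t), hu.of_le ?_ (Eventually.of_forall fun t => hPle _),
    Eventually.of_forall fun t => hP _⟩
  exact (hPm.comp_aemeasurable hu.1.aemeasurable).aestronglyMeasurable

/-- Pointwise this is the tangent inequality for the convex function ½(s⁺)², whose derivative is s⁺.
-/
theorem inner_sub_posPart_le {n : ℕ} {Ω : Set (Eucl n)} (x y : L2Space Ω) :
    ⟪x - y, Lp.posPart y⟫ ≤ 2⁻¹ * ‖Lp.posPart x‖ ^ 2 - 2⁻¹ * ‖Lp.posPart y‖ ^ 2 := by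
  rw [← real_inner_self_eq_norm_sq, ← real_inner_self_eq_norm_sq, L2.inner_def, L2.inner_def,
    L2.inner_def, ← integral_const_mul, ← integral_const_mul, ← integral_sub
    ((L2.integrable_inner _ _).const_mul _) ((L2.integrable_inner _ _).const_mul _)]
  refine integral_mono_ae (L2.integrable_inner _ _)
    (((L2.integrable_inner _ _).const_mul _).sub ((L2.integrable_inner _ _).const_mul _)) ?_
  filter_upwards [Lp.coeFn_sub x y, Lp.coeFn_posPart x, Lp.coeFn_posPart y] with t h1 h2 h3
  simp only [h1, h2, h3, Pi.sub_apply, RCLike.inner_apply, conj_trivial]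
  rcases le_total 0 (x t) with hx | hx <;> rcases le_total 0 (y t) with hy | hy <;>
    simp only [max_eq_left, max_eq_right, hx, hy] <;> nlinarith [sq_nonneg (x t - y t)]

/-- Zero extension of `u'`, read in `V` through the Riesz isomorphism, together with a set of full
measure on which `u` has the increments prescribed by `u'`. -/
theorem IsInW.exists_increment {n : ℕ} {Ω : Set (Eucl n)} {T : ℝ} (hT : 0 < T)
    {u : ℝ → SobolevH1 Ω} {u' : ℝ → SobolevH1Dual Ω} (hu : IsInW Ω T u u') :
    ∃ (f : ℝ → SobolevH1 Ω) (S : Set ℝ), MemLp f 2 volume ∧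
      (∀ t ∈ Ioo 0 T, ∀ v, ⟪f t, v⟫ = u' t v) ∧
      (∀ᵐ t ∂(volume.restrict (Ioo 0 T)), t ∈ S) ∧
      ∀ s ∈ S, ∀ t ∈ S, ∀ v, ⟪SobolevH1.toL2 Ω (u t) - SobolevH1.toL2 Ω (u s),
        SobolevH1.toL2 Ω v⟫ = ⟪∫ r in s..t, f r, v⟫ := by
  have hui : IntegrableOn u (Ioo 0 T) := hu.memLp.integrable one_le_two
  have hu'i : IntegrableOn u' (Ioo 0 T) := hu.memLp_deriv.integrable one_le_two
  let J : SobolevH1 Ω →L[ℝ] SobolevH1Dual Ω :=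
    (((ContinuousLinearMap.compL ℝ (SobolevH1 Ω) (L2Space Ω) ℝ).flip (SobolevH1.toL2 Ω)).comp
      (innerSL ℝ)).comp (SobolevH1.toL2 Ω)
  have hJ : ∀ v, J v = SobolevH1.toDual Ω v := fun v => rfl
  have hJu : IntegrableOn (fun t => SobolevH1.toDual Ω (u t)) (Ioo 0 T) := J.integrable_comp hui
  obtain ⟨c, hc⟩ := hu.weakDeriv.exists_ae_eq_add_integral hT hJu hu'i
  let R : SobolevH1Dual Ω →L[ℝ] SobolevH1 Ω :=
    ((InnerProductSpace.toDual ℝ (SobolevH1 Ω)).symm : SobolevH1Dual Ω ≃ₗᵢ[ℝ] SobolevH1 Ω)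
      |>.toContinuousLinearEquiv.toContinuousLinearMap
  have hR : ∀ (ξ : SobolevH1Dual Ω) v, ⟪R ξ, v⟫ = ξ v := fun ξ v =>
    InnerProductSpace.toDual_symm_apply
  have hf : MemLp ((Ioo 0 T).indicator fun t => R (u' t)) 2 volume :=
    (memLp_indicator_iff_restrict measurableSet_Ioo).2 (R.comp_memLp' hu.memLp_deriv)
  refine ⟨_, Ioo 0 T ∩ {t | SobolevH1.toDual Ω (u t) = c + ∫ s in (0 : ℝ)..t, u' s}, hf, ?_, ?_, ?_⟩
  · intro t ht v
    rw [indicator_of_mem ht, hR]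
  · filter_upwards [hc, ae_restrict_mem measurableSet_Ioo] with t h1 h2 using ⟨h2, h1⟩
  · rintro s ⟨hsI, hs⟩ t ⟨htI, ht⟩ v
    have hii : ∀ x ∈ Ioo 0 T, IntervalIntegrable u' volume 0 x := fun x hx => by
      rw [intervalIntegrable_iff_integrableOn_Ioo_of_le hx.1.le]
      exact hu'i.mono_set (Ioo_subset_Ioo_right hx.2.le)
    have e1 : SobolevH1.toDual Ω (u t) - SobolevH1.toDual Ω (u s) = ∫ r in s..t, u' r := by
      rw [hs, ht, add_sub_add_left_eq_sub,
        intervalIntegral.integral_interval_sub_left (hii t htI) (hii s hsI)]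
    have hsub : uIcc s t ⊆ Ioo 0 T := ordConnected_Ioo.uIcc_subset hsI htI
    have e2 : ∫ r in s..t, (Ioo 0 T).indicator (fun t => R (u' t)) r = R (∫ r in s..t, u' r) := by
      rw [← R.intervalIntegral_comp_comm ((hii s hsI).symm.trans (hii t htI))]
      exact intervalIntegral.integral_congr fun r hr => indicator_of_mem (hsub hr) _
    rw [e2, hR, ← e1]
    simp [SobolevH1.toDual, inner_sub_left]

theorem lemma3p3 {n : ℕ} (Ω : Set (Eucl n)) (hΩ : IsOpen Ω) (T : ℝ) (hT : 0 < T)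
    (u : ℝ → SobolevH1 Ω) (u' : ℝ → SobolevH1Dual Ω) (hu : IsInW Ω T u u') :
    ∃ (ub : ℝ → L2Space Ω) (up : ℝ → SobolevH1 Ω) (d : ℝ → ℝ),
      IsContRep Ω T u ub ∧
      IsPosPartInL2V Ω T u up ∧
      IntegrableOn (fun t => u' t (up t)) (Ioo 0 T) ∧
      IntegrableOn d (Ioo 0 T) ∧
      HasWeakTimeDeriv T (fun t => ‖Lp.posPart (ub t)‖ ^ 2) d ∧
      (∫ t in Ioo 0 T, u' t (up t)) = (1 / 2) * (∫ t in Ioo 0 T, d t) ∧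
      (1 / 2) * (∫ t in Ioo 0 T, d t)
        = (1 / 2) * (‖Lp.posPart (ub T)‖ ^ 2 - ‖Lp.posPart (ub 0)‖ ^ 2) := by
  obtain ⟨f, S, hf, hfu, hS, hdiff⟩ := hu.exists_increment hT
  obtain ⟨up, hup⟩ := exists_isPosPartInL2V hΩ hu.memLp
  -- Zero extension, since the time lemmas work with L² functions on the whole line.
  have hu0 : MemLp ((Ioo 0 T).indicator u) 2 volume :=
    (memLp_indicator_iff_restrict measurableSet_Ioo).2 hu.memLp
  have hp0 : MemLp ((Ioo 0 T).indicator up) 2 volume :=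
    (memLp_indicator_iff_restrict measurableSet_Ioo).2 hup.memLp
  have hmem : ∀ᵐ t ∂(volume.restrict (Ioo 0 T)), t ∈ Ioo 0 T := ae_restrict_mem measurableSet_Ioo
  have hS' : ∀ᵐ t ∂(volume.restrict (Ioo 0 T)), t ∈ S ∩ Ioo 0 T := hS.and hmem
  have hdiff' : ∀ s ∈ S ∩ Ioo 0 T, ∀ t ∈ S ∩ Ioo 0 T, ∀ v,
      ⟪SobolevH1.toL2 Ω ((Ioo 0 T).indicator u t) - SobolevH1.toL2 Ω ((Ioo 0 T).indicator u s),
        SobolevH1.toL2 Ω v⟫ = ⟪∫ r in s..t, f r, v⟫ := by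
    rintro s ⟨hs, hsI⟩ t ⟨ht, htI⟩ v
    rw [indicator_of_mem hsI, indicator_of_mem htI]
    exact hdiff s hs t ht v
  obtain ⟨ub, hubc, hubu⟩ := exists_continuous_representative hT hu0 hf hS' hdiff'
  have hubu' : ∀ᵐ t ∂(volume.restrict (Ioo 0 T)), ub t = SobolevH1.toL2 Ω (u t) := by
    filter_upwards [hubu, hmem] with t h1 h2
    rwa [indicator_of_mem h2] at h1
  have hchain := chain_rule_of_subgradient hT (u := u) hf hp0 hS hdiff hubc hubu'
    (Φ := fun x => 2⁻¹ * ‖Lp.posPart x‖ ^ 2) (D := Lp.posPart)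
    (by have := Lp.continuous_posPart (p := 2) (μ := volume.restrict Ω); fun_prop)
    inner_sub_posPart_le (by
      filter_upwards [hup.ae_eq, hmem] with t h1 h2
      rwa [indicator_of_mem h2])
  have hpair : ∀ t ∈ Ioo 0 T, ⟪f t, (Ioo 0 T).indicator up t⟫ = u' t (up t) := fun t ht => by
    rw [indicator_of_mem ht, hfu t ht]
  have hint : IntegrableOn (fun t => u' t (up t)) (Ioo 0 T) :=
    (hf.integrable_inner_real hp0).integrableOn.congr_fun hpair measurableSet_Ioo
  have hsq : ∀ t ∈ Icc 0 T, ‖Lp.posPart (ub t)‖ ^ 2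
      = ‖Lp.posPart (ub 0)‖ ^ 2 + ∫ r in (0 : ℝ)..t, 2 * u' r (up r) := by
    intro t ht
    have h1 := hchain t ht
    have h2 : ∫ r in (0 : ℝ)..t, ⟪f r, (Ioo 0 T).indicator up r⟫
        = ∫ r in (0 : ℝ)..t, u' r (up r) := by
      rw [intervalIntegral.integral_of_le ht.1, intervalIntegral.integral_of_le ht.1,
        integral_Ioc_eq_integral_Ioo, integral_Ioc_eq_integral_Ioo]
      exact setIntegral_congr_fun measurableSet_Ioo fun r hr => hpair r ⟨hr.1, hr.2.trans_le ht.2⟩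
    rw [intervalIntegral.integral_const_mul, ← h2]
    linarith
  have hd : IntegrableOn (fun t => 2 * u' t (up t)) (Ioo 0 T) := hint.const_mul 2
  -- The integral formula `hsq` identifies the weak derivative of ‖u⁺‖² as 2⟨∂ₜu, u⁺⟩.
  refine ⟨ub, up, fun t => 2 * u' t (up t), ⟨hubc, hubu'⟩, hup, hint, hd, ?_, ?_, ?_⟩
  · intro φ h1 h2 h3
    rw [← hasWeakTimeDeriv_primitive_real hT hd (‖Lp.posPart (ub 0)‖ ^ 2) φ h1 h2 h3]
    refine setIntegral_congr_fun measurableSet_Ioo fun t ht => ?_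
    simp only [hsq t (Ioo_subset_Icc_self ht)]
  · rw [integral_const_mul]
    ring
  · rw [hsq T ⟨hT.le, le_rfl⟩, intervalIntegral.integral_of_le hT.le, integral_Ioc_eq_integral_Ioo]
    ring
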